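/- **Derivative side.** For real $\mu>1$ and real $x>-1$ let $$d_\Gamma(x,\mu)=-\frac{1}{\Gamma(\mu)}\Big(\frac{\mathrm d}{\mathrm dz}\Big)^{\mu}\ln\Gamma(z+1)\Big|_{z=x}:=-\frac1{\Gamma(\mu)}\lim_{\varepsilon\to0^+}\frac1{2\pi}\int_{-\infty}^{\infty}(i\xi)^{\mu}\,\mathcal F[\ln|\Gamma(\cdot+1)|](\xi)\,e^{ix\xi}e^{-\varepsilon|\xi|}\,\mathrm d\xi ,$$ where $(i\xi)^\mu=e^{i\pi\mu/2}\xi^\mu$ with $\xi^\mu=e^{i\pi\mu}|\xi|^\mu$ for $\xi<0$, and $\mathcal F$ is the distributional Fourier transform, so that the integral means $\int_{-\infty}^\infty\ln|\Gamma(y+1)|\,\Big(\int_{-\infty}^\infty(i\xi)^\mu e^{ix\xi-\varepsilon|\xi|}e^{-iy\xi}\,\mathrm d\xi\Big)\mathrm dy$. For each real $x>-1$ the function $d_\Gamma(x,\cdot)$ is continued analytically to $\mu\in\mathbb C\setminus\{1\}$, and then, for each $\mu\ne1$, $d_\Gamma(\cdot,\mu)$ is continued analytically to $z_0\in\mathbb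 C\setminus(-\infty,-1]$. **Theorem.** The limit and both analytic continuations exist, and they are unique; so $d_\Gamma(z_0,\mu)$ is well defined for $z_0\in\mathbb C\setminus(-\infty,-1]$, $\mu\in\mathbb C\setminus\{1\}$. For every $\mu\in\mathbb R\setminus\mathbb Z$ it has the Euler–Maclaurin-type asymptotic expansion $$d_\Gamma(z_0,\mu)\sim\frac{e^{i\pi(\mu-1)}}{(\mu-1)(z_0+1)^{\mu-1}}-\frac{e^{i\pi\mu}}{2(z_0+1)^{\mu}}+\sum_{k\ge1}\frac{\mu(\mu+1)\cdots(\mu+2k-2)B_{2k}}{(2k)!}\,\frac{e^{i\pi(\mu+2k-1)}}{(z_0+1)^{\mu+2k-1}}$$ $$=-\frac{e^{i\pi\mu}}{(\mu-1)(z_0+1)^{\mu-1}}\Big\{1+\frac{\mu-1}{2(z_0+1)}+\sum_{k\ge1}\frac{(\mu-1)\mu\cdots(\mu+2k-2)B_{2k}}{(2k)!\,(z_0+1)^{2k}}\Big\}$$ as $z_0\to\infty$ away from the cut $(-\infty,-1]$. Here $B_{2k}$ are the Bernoulli numbers and the powers of $z_0+1$ are principal. That is, for every $K\ge0$ the two expressions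 with the sums cut off after $k=K$ coincide on $\mathbb C\setminus(-\infty,-1]$, and for every $\delta>0$ each of them differs from $d_\Gamma(z_0,\mu)$ by $O\big(|z_0+1|^{-(\mu+2K+1)}\big)$ as $|z_0|\to\infty$ in the sector $|\arg(z_0+1)|\le\pi-\delta$, the implied constant depending only on $\mu$, $K$ and $\delta$. -/

import Mathlib

open Filter Topology Asymptotics

noncomputable section

namespace GammaRoot

/-- The power `(iξ)^ρ = e^{iπρ/2} ξ^ρ` of a real `ξ`, where `ξ^ρ = e^{iπρ} |ξ|^ρ` for `ξ < 0`
(the argument of a negative `ξ` is `π`).  This is the branch that extends to the upper half plane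
in `ξ`; it is not the principal power of `iξ` when `ξ < 0`. -/
def iMulPow (ξ : ℝ) (ρ : ℂ) : ℂ :=
  Complex.exp (Complex.I * Real.pi / 2 * ρ) * (ξ : ℂ) ^ ρ

/-- The regularised Fourier multiplier `(iξ)^μ e^{ixξ} e^{-ε|ξ|}`: the symbol of `(d/dz)^μ`,
evaluated at `x`, with an Abel convergence factor. -/
def fracDerivSymbol (ε x μ ξ : ℝ) : ℂ :=
  iMulPow ξ μ * Complex.exp (Complex.I * x * ξ) * Complex.exp (-(ε * |ξ| : ℝ))

/-- The Fourier transform `𝓕[φ](y) = ∫ φ(ξ) e^{-iyξ} dξ`. -/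
def fourierT (φ : ℝ → ℂ) (y : ℝ) : ℂ :=
  ∫ ξ : ℝ, φ ξ * Complex.exp (-(Complex.I * y * ξ))

/-- The derivative side `-1/Γ(μ) (d/dz)^μ (ln f)` at a real point `x` in its Fourier form,
`-1/Γ(μ) · 1/(2π) ∫ (iξ)^μ 𝓕[ln f](ξ) e^{ixξ} dξ`, with Abel factor `e^{-ε|ξ|}`.
Here `𝓕[ln f]` is the distributional Fourier transform of `ln |f|` on the real line, so its
pairing with `φ` is `∫ ln |f(y)| 𝓕[φ](y) dy`.  The derivative side is the limit `ε → 0+`. -/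
def derivSideIntegral (f : ℂ → ℂ) (ε x μ : ℝ) : ℂ :=
  -(1 / Complex.Gamma μ) * (1 / (2 * Real.pi)) *
    ∫ y : ℝ, (Real.log ‖f y‖ : ℂ) * fourierT (fracDerivSymbol ε x μ) y

/-- The complex plane cut along `(-∞, -1]`. -/
def cutPlane : Set ℂ := {z | z + 1 ∈ Complex.slitPlane}

/-- `d z μ` is the derivative side for `Γ(z+1)`: for real `μ > 1` and real `z > -1` it is the
Abel limit of the Fourier integral; it is then continued analytically in `μ`, to `ℂ ∖ {1}`, for every
real `z > -1`, and finally, for every `μ ≠ 1`, in `z` to the cut plane. -/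
structure IsGammaDerivSide (d : ℂ → ℂ → ℂ) : Prop where
  integral : ∀ x μ : ℝ, -1 < x → 1 < μ →
    Tendsto (fun ε : ℝ => derivSideIntegral (fun z => Complex.Gamma (z + 1)) ε x μ) (𝓝[>] 0) (𝓝 (d x μ))
  analytic_mu : ∀ x : ℝ, -1 < x → DifferentiableOn ℂ (fun μ => d x μ) {1}ᶜ
  analytic_z : ∀ μ : ℂ, μ ≠ 1 → DifferentiableOn ℂ (fun z => d z μ) cutPlane

open Classical in
/-- The derivative side `d_Γ(z, μ)` of the root identities for `Γ(z+1)`, defined by the Fourier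
integral and analytic continuation. -/
def gammaDerivSide : ℂ → ℂ → ℂ :=
  if h : ∃ d, IsGammaDerivSide d then h.choose else 0

/-- The sector `|arg (z+1)| ≤ π - δ` with vertex `-1` (the vertex is excluded). -/
def sector (δ : ℝ) : Set ℂ := {z | z + 1 ≠ 0 ∧ |(z + 1).arg| ≤ Real.pi - δ}

/-- The expansion written as a sum of powers of `z+1`, with the Bernoulli terms up to `B_{2K}`:
`e^{iπ(μ-1)} / ((μ-1)(z+1)^(μ-1)) - e^{iπμ} / (2 (z+1)^μ)
  + ∑ μ(μ+1)⋯(μ+2k-2) B_{2k} / (2k)! · e^{iπ(μ+2k-1)} / (z+1)^(μ+2k-1)`. -/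
def expansionSum (μ : ℝ) (K : ℕ) (z : ℂ) : ℂ :=
  1 / ((μ : ℂ) - 1) * Complex.exp (Complex.I * Real.pi * (μ - 1)) * (1 / (z + 1) ^ ((μ : ℂ) - 1))
    - 1 / 2 * Complex.exp (Complex.I * Real.pi * μ) * (1 / (z + 1) ^ (μ : ℂ))
    + ∑ k ∈ Finset.Icc 1 K,
        (∏ i ∈ Finset.range (2 * k - 1), ((μ : ℂ) + i)) * ((bernoulli (2 * k) : ℚ) : ℂ)
          / ((2 * k).factorial : ℂ)
          * Complex.exp (Complex.I * Real.pi * (μ + 2 * k - 1))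
          * (1 / (z + 1) ^ ((μ : ℂ) + 2 * k - 1))

/-- The expansion with the leading power factored out, with the Bernoulli terms up to `B_{2K}`:
`-e^{iπμ} / ((μ-1)(z+1)^(μ-1)) ·
  {1 + (μ-1) / (2(z+1)) + ∑ (μ-1)μ⋯(μ+2k-2) B_{2k} / ((2k)! (z+1)^(2k))}`. -/
def expansionFactored (μ : ℝ) (K : ℕ) (z : ℂ) : ℂ :=
  -(Complex.exp (Complex.I * Real.pi * μ) / ((μ : ℂ) - 1)) * (1 / (z + 1) ^ ((μ : ℂ) - 1)) *
    (1 + 1 / 2 * (((μ : ℂ) - 1) / (z + 1))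
      + ∑ k ∈ Finset.Icc 1 K,
          (∏ i ∈ Finset.range (2 * k), ((μ : ℂ) - 1 + i)) * ((bernoulli (2 * k) : ℚ) : ℂ)
            / (((2 * k).factorial : ℂ) * (z + 1) ^ (2 * k)))

end GammaRoot

end

/-! The derivative side is a Hurwitz zeta function in disguise, `d_Γ(z, μ) = -e^{iπμ} ζ(μ, z + 1)`,
and the expansion is the Euler–Maclaurin expansion of `ζ(μ, a)` at `a = z + 1`.

For real `μ > 1` and `x > -1`, put `w = x + iε`. The regularised symbol has as Fourier transform a
combination of the two conjugate kernels `(y - w)^{-(μ+1)}` and `(y - w̄)^{-(μ+1)}`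
(`fourierT_fracDerivSymbol`). Pair them with the Weierstrass series of `log |Γ(y + 1)|`. Constants
and linear functions integrate to zero against such a kernel, so only the logarithms `log |y + k|`,
`k ≥ 1`, contribute. Now `log z · (z - w)^{-(μ+1)}` is holomorphic below the real axis, where its
boundary value is `(log |v| - iπ 1_{v<0}) (v - w)^{-(μ+1)}`. By Cauchy's theorem the integral of
`log |v|` against the kernel reduces to an elementary integral over the negative half line
(`integral_log_mul_ofReal_sub_cpow`). Summing over `k` and letting `ε → 0+` gives the Hurwitz series
(`tendsto_derivSideIntegral`).

The continuation of that series comes from Euler–Maclaurin summation. The approximant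
`hurwitzApprox` satisfies the functional equation of `ζ(s, a)` up to a defect that decays fast
enough to be summed over `a, a + 1, a + 2, …`. The result does not depend on the order, is
holomorphic in each variable, and differs from a lower-order approximant by the size of the first
omitted term. Uniqueness is the identity theorem, applied first in `μ` and then in `z`
(`IsGammaDerivSide.eq`). -/

namespace GammaRoot

/-! ### The Hurwitz zeta function on the slit plane -/

/-- The `j`-th derivative of `a ↦ a ^ (1 - s)`. -/
noncomputable def hurwitzTerm (s : ℂ) (j : ℕ) (a : ℂ) : ℂ :=
  (-1) ^ j * (∏ i ∈ Finset.range j, (s - 1 + i)) * a ^ (1 - s - j)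

/-- The Euler–Maclaurin expansion of the Hurwitz zeta function, with Bernoulli terms up to `B_n`. -/
noncomputable def hurwitzApprox (s : ℂ) (n : ℕ) (a : ℂ) : ℂ :=
  1 / (s - 1) * ∑ j ∈ Finset.range (n + 1),
    ((bernoulli j : ℚ) : ℂ) / (j.factorial : ℂ) * hurwitzTerm s j a

/-- The defect of `hurwitzApprox` in the functional equation `ζ(s, a) = a ^ (-s) + ζ(s, a + 1)`. -/
noncomputable def hurwitzDefect (s : ℂ) (n : ℕ) (a : ℂ) : ℂ :=
  a ^ (-s) - hurwitzApprox s n a + hurwitzApprox s n (a + 1)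

/-- The Hurwitz zeta function `ζ(s, a)` for `a` in the slit plane and `s ≠ 1`. -/
noncomputable def hurwitz (s a : ℂ) : ℂ :=
  hurwitzApprox s (⌈‖s‖⌉₊ + 2) a + ∑' k : ℕ, hurwitzDefect s (⌈‖s‖⌉₊ + 2) (a + k)

/-! ### Euler–Maclaurin on the unit interval. -/

lemma add_ofReal_mem_slitPlane {a : ℂ} (ha : a ∈ Complex.slitPlane) {r : ℝ} (hr : 0 ≤ r) :
    a + r ∈ Complex.slitPlane := by
  rw [Complex.mem_slitPlane_iff] at ha ⊢
  simp only [Complex.add_re, Complex.ofReal_re, Complex.add_im, Complex.ofReal_im, add_zero]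
  rcases ha with h | h
  · left; linarith
  · right; exact h

lemma add_natCast_mem_slitPlane {a : ℂ} (ha : a ∈ Complex.slitPlane) (k : ℕ) :
    a + k ∈ Complex.slitPlane := by
  simpa using add_ofReal_mem_slitPlane ha (Nat.cast_nonneg k)

lemma hasDerivAt_hurwitzTerm (s : ℂ) (j : ℕ) {a : ℂ} (ha : a ∈ Complex.slitPlane) :
    HasDerivAt (hurwitzTerm s j) (hurwitzTerm s (j + 1) a) a := by
  have h := ((hasDerivAt_id a).cpow_const (c := 1 - s - j) ha).const_mul
    ((-1) ^ j * (∏ i ∈ Finset.range j, (s - 1 + i)))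
  refine h.congr_deriv ?_
  simp only [hurwitzTerm, Finset.prod_range_succ, id]
  rw [show (1 - s - ((j + 1 : ℕ) : ℂ)) = 1 - s - j - 1 by push_cast; ring]
  ring

lemma hasDerivAt_hurwitzTerm_line (s : ℂ) (j : ℕ) {a : ℂ} (ha : a ∈ Complex.slitPlane) {t : ℝ}
    (ht : 0 ≤ t) :
    HasDerivAt (fun t : ℝ => hurwitzTerm s j (a + t)) (hurwitzTerm s (j + 1) (a + t)) t := by
  have h1 : HasDerivAt (fun t : ℝ => a + (t : ℂ)) 1 t := by
    simpa using (Complex.ofRealCLM.hasDerivAt (x := t)).const_add a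
  exact ((hasDerivAt_hurwitzTerm s j (add_ofReal_mem_slitPlane ha ht)).comp t h1).congr_deriv
    (mul_one _)

lemma continuousOn_hurwitzTerm_line (s : ℂ) (j : ℕ) {a : ℂ} (ha : a ∈ Complex.slitPlane) :
    ContinuousOn (fun t : ℝ => hurwitzTerm s j (a + t)) (Set.uIcc 0 1) := by
  intro t ht
  rw [Set.uIcc_of_le zero_le_one] at ht
  exact (hasDerivAt_hurwitzTerm_line s j ha ht.1).continuousAt.continuousWithinAt

/-- Integration by parts against Bernoulli polynomials over the unit interval. -/
lemma integral_bernoulliFun_mul_hurwitzTerm (s : ℂ) (n : ℕ) {a : ℂ} (ha : a ∈ Complex.slitPlane) :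
    ∫ t in (0 : ℝ)..1, ((bernoulliFun n t / n.factorial : ℝ) : ℂ) * hurwitzTerm s (n + 1) (a + t)
      = ((bernoulliFun (n + 1) 1 / (n + 1).factorial : ℝ) : ℂ) * hurwitzTerm s (n + 1) (a + 1)
        - ((bernoulliFun (n + 1) 0 / (n + 1).factorial : ℝ) : ℂ) * hurwitzTerm s (n + 1) a
        - ∫ t in (0 : ℝ)..1, ((bernoulliFun (n + 1) t / (n + 1).factorial : ℝ) : ℂ) *
            hurwitzTerm s (n + 2) (a + t) := by
  have h := intervalIntegral.integral_mul_deriv_eq_deriv_mul (a := (0 : ℝ)) (b := 1)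
    (u := fun t : ℝ => ((bernoulliFun (n + 1) t / (n + 1).factorial : ℝ) : ℂ))
    (u' := fun t : ℝ => ((bernoulliFun n t / n.factorial : ℝ) : ℂ))
    (v := fun t : ℝ => hurwitzTerm s (n + 1) (a + t))
    (v' := fun t : ℝ => hurwitzTerm s (n + 2) (a + t)) ?_ ?_ ?_ ?_
  · rw [h]; simp
  · intro t _
    refine HasDerivAt.ofReal_comp ?_
    refine ((hasDerivAt_bernoulliFun (n + 1) t).div_const _).congr_deriv ?_
    rw [Nat.factorial_succ]
    push_cast
    have : ((n.factorial : ℝ)) ≠ 0 := by positivity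
    have h2 : ((n : ℝ) + 1) ≠ 0 := by positivity
    field_simp
  · intro t ht
    rw [Set.uIcc_of_le zero_le_one] at ht
    exact hasDerivAt_hurwitzTerm_line s (n + 1) ha ht.1
  · exact Continuous.intervalIntegrable (by fun_prop) _ _
  · exact (continuousOn_hurwitzTerm_line s (n + 2) ha).intervalIntegrable

lemma hurwitzTerm_one (s a : ℂ) : hurwitzTerm s 1 a = -(s - 1) * a ^ (-s) := by
  simp [hurwitzTerm]

/-- The two conventions for Bernoulli numbers differ by the factor `(-1)^n` and agree away from
index 1. This absorbs the alternating sign produced by repeated integration by parts. -/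
lemma neg_one_pow_mul_bernoulli {n : ℕ} (hn : n ≠ 1) :
    (-1) ^ n * ((bernoulli n : ℚ) : ℂ) = ((bernoulli n : ℚ) : ℂ) := by
  have := bernoulli'_eq_bernoulli n
  rw [← bernoulli_eq_bernoulli'_of_ne_one hn] at this
  exact_mod_cast this.symm

/-- The Euler–Maclaurin formula on the unit interval. -/
lemma hurwitzDefect_eq_integral {s : ℂ} (hs : s ≠ 1) (n : ℕ) {a : ℂ} (ha : a ∈ Complex.slitPlane) :
    hurwitzDefect s (n + 1) a = 1 / (s - 1) * ((-1) ^ (n + 1) *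
      ∫ t in (0 : ℝ)..1, ((bernoulliFun (n + 1) t / (n + 1).factorial : ℝ) : ℂ) *
        hurwitzTerm s (n + 2) (a + t)) := by
  have hs' : s - 1 ≠ 0 := sub_ne_zero.2 hs
  induction n with
  | zero =>
    -- Order 1 is treated separately: `B₁(t) = t - 1/2` has opposite values at the endpoints, which
    -- gives the trapezoidal rule.
    have h := integral_bernoulliFun_mul_hurwitzTerm s 0 ha
    have h0 : ∫ t in (0 : ℝ)..1, ((bernoulliFun 0 t / (Nat.factorial 0) : ℝ) : ℂ) *
        hurwitzTerm s (0 + 1) (a + t) = hurwitzTerm s 0 (a + 1) - hurwitzTerm s 0 a := by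
      have := intervalIntegral.integral_eq_sub_of_hasDerivAt (a := (0 : ℝ)) (b := 1)
        (f := fun t : ℝ => hurwitzTerm s 0 (a + t)) (f' := fun t : ℝ => hurwitzTerm s 1 (a + t))
        (fun t ht => hasDerivAt_hurwitzTerm_line s 0 ha
          (by rw [Set.uIcc_of_le zero_le_one] at ht; exact ht.1))
        (continuousOn_hurwitzTerm_line s 1 ha).intervalIntegrable
      simpa using this
    rw [h0] at h
    have hI : ∫ t in (0 : ℝ)..1, ((bernoulliFun (0 + 1) t / (0 + 1).factorial : ℝ) : ℂ) *
        hurwitzTerm s (0 + 2) (a + t) = 1 / 2 * hurwitzTerm s 1 (a + 1) + 1 / 2 * hurwitzTerm s 1 a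
          - (hurwitzTerm s 0 (a + 1) - hurwitzTerm s 0 a) := by
      rw [h]
      simp only [zero_add, bernoulliFun_one, Nat.factorial_one]
      push_cast
      ring
    rw [hI]
    simp only [hurwitzDefect, hurwitzApprox, Finset.sum_range_succ, Finset.sum_range_zero,
      hurwitzTerm_one]
    simp
    field_simp
    ring
  | succ n ih =>
    have h := integral_bernoulliFun_mul_hurwitzTerm s (n + 1) ha
    -- From degree 2 on the Bernoulli polynomials agree at 0 and 1, so the boundary terms are
    -- exactly the increment of the new summand of `hurwitzApprox`.
    have hb := bernoulliFun_endpoints_eq_of_ne_one (k := n + 1 + 1) (by omega)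
    rw [hb, bernoulliFun_eval_zero] at h
    have hstep : hurwitzDefect s (n + 1 + 1) a = hurwitzDefect s (n + 1) a + 1 / (s - 1) *
        (((bernoulli (n + 2) : ℚ) : ℂ) / ((n + 2).factorial : ℂ) *
          (hurwitzTerm s (n + 2) (a + 1) - hurwitzTerm s (n + 2) a)) := by
      simp only [hurwitzDefect, hurwitzApprox, Finset.sum_range_succ _ (n + 1 + 1)]
      ring
    rw [hstep, ih, h]
    have hn := neg_one_pow_mul_bernoulli (n := n + 2) (by omega)
    rw [← hn]
    push_cast
    ring

/-! ### Uniform bounds for the defect. -/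

lemma norm_cpow_le_mul_exp (z c : ℂ) :
    ‖z ^ c‖ ≤ ‖z‖ ^ c.re * Real.exp (Real.pi * |c.im|) := by
  refine (Complex.norm_cpow_le z c).trans ?_
  rw [div_eq_mul_inv, ← Real.exp_neg]
  gcongr
  calc -(z.arg * c.im) ≤ |z.arg * c.im| := neg_le_abs _
    _ = |z.arg| * |c.im| := abs_mul _ _
    _ ≤ Real.pi * |c.im| := by gcongr; exact Complex.abs_arg_le_pi z

/-- The Bernoulli factor is bounded on the unit interval, and the factor `s - 1` in the derivative
of `a ^ (1 - s)` cancels the prefactor `1 / (s - 1)`. Hence the constant depends on neither `s` nor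
`a`. -/
lemma exists_norm_hurwitzDefect_le (n : ℕ) : ∃ C : ℝ, 0 ≤ C ∧ ∀ s : ℂ, s ≠ 1 →
    0 ≤ s.re + (n + 1) → ∀ a ∈ Complex.slitPlane, ∀ m : ℝ, 0 < m →
    (∀ t : ℝ, 0 ≤ t → m ≤ ‖a + t‖) →
    ‖hurwitzDefect s (n + 1) a‖ ≤ C * (∏ i ∈ Finset.range (n + 1), ‖s + i‖) *
      Real.exp (Real.pi * |s.im|) * m ^ (-(s.re + (n + 1))) := by
  obtain ⟨C, hC⟩ := isCompact_Icc.exists_bound_of_continuousOn (s := Set.Icc (0 : ℝ) 1)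
    (f := fun t : ℝ => bernoulliFun (n + 1) t / (n + 1).factorial) (by fun_prop)
  have hC0 : 0 ≤ C := (norm_nonneg _).trans (hC 0 (by simp))
  refine ⟨C, hC0, fun s hs hq a ha m hm hma => ?_⟩
  have hs' : ‖s - 1‖ ≠ 0 := norm_ne_zero_iff.2 (sub_ne_zero.2 hs)
  rw [hurwitzDefect_eq_integral hs n ha, norm_mul, norm_mul, norm_pow, norm_neg, norm_one, one_pow,
    one_mul, norm_div, norm_one]
  have hterm : ∀ t : ℝ, 0 ≤ t → ‖hurwitzTerm s (n + 2) (a + t)‖ ≤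
      ‖s - 1‖ * ((∏ i ∈ Finset.range (n + 1), ‖s + i‖) *
        Real.exp (Real.pi * |s.im|) * m ^ (-(s.re + (n + 1)))) := by
    intro t ht
    have h1 := norm_cpow_le_mul_exp (a + t) (1 - s - (n + 2 : ℕ))
    have hre : (1 - s - ((n + 2 : ℕ) : ℂ)).re = -(s.re + (n + 1)) := by
      simp; ring
    have him : (1 - s - ((n + 2 : ℕ) : ℂ)).im = -s.im := by simp
    rw [hre, him, abs_neg] at h1
    have h2 : ‖a + t‖ ^ (-(s.re + (n + 1))) ≤ m ^ (-(s.re + (n + 1))) :=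
      Real.rpow_le_rpow_of_nonpos hm (hma t ht) (by linarith)
    rw [hurwitzTerm, norm_mul, norm_mul, norm_pow, norm_neg, norm_one, one_pow, one_mul,
      Finset.prod_range_succ', norm_mul, norm_prod]
    have h3 : ∀ i : ℕ, s - 1 + ((i + 1 : ℕ) : ℂ) = s + i := by intro i; push_cast; ring
    simp only [h3, Nat.cast_zero, add_zero]
    calc _ ≤ (∏ x ∈ Finset.range (n + 1), ‖s + x‖) * ‖s - 1‖ *
          (m ^ (-(s.re + (n + 1))) * Real.exp (Real.pi * |s.im|)) := by
          gcongr
          exact h1.trans (by gcongr)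
      _ = _ := by ring
  have hint := intervalIntegral.norm_integral_le_of_norm_le_const (a := (0 : ℝ)) (b := 1)
    (f := fun t : ℝ => ((bernoulliFun (n + 1) t / (n + 1).factorial : ℝ) : ℂ) *
        hurwitzTerm s (n + 2) (a + t))
    (C := C * (‖s - 1‖ * ((∏ i ∈ Finset.range (n + 1), ‖s + i‖) *
        Real.exp (Real.pi * |s.im|) * m ^ (-(s.re + (n + 1)))))) (by
      intro t ht
      rw [Set.uIoc_of_le zero_le_one] at ht
      rw [norm_mul, Complex.norm_real]
      gcongr
      · exact hC t ⟨ht.1.le, ht.2⟩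
      · exact hterm t ht.1.le)
  rw [sub_zero, abs_one, mul_one] at hint
  calc _ ≤ 1 / ‖s - 1‖ * (C * (‖s - 1‖ * ((∏ i ∈ Finset.range (n + 1), ‖s + i‖) *
        Real.exp (Real.pi * |s.im|) * m ^ (-(s.re + (n + 1)))))) := by gcongr
    _ = _ := by field_simp

/-- Two powers of the decay are spent on summability in `k`; the rest stays as a power of `A`.
Holomorphy uses `A = 1`, the asymptotic expansion uses `A = ‖a‖`. -/
lemma exists_norm_hurwitzDefect_add_natCast_le (n : ℕ) (M c : ℝ) (hc : 0 < c) (hc1 : c ≤ 1) :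
    ∃ C : ℝ, 0 ≤ C ∧ ∀ s : ℂ, s ≠ 1 → ‖s‖ ≤ M → 2 ≤ s.re + (n + 1) →
      ∀ a ∈ Complex.slitPlane, ∀ A : ℝ, 1 ≤ A → (∀ r : ℝ, 0 ≤ r → c * (A + r) ≤ ‖a + r‖) →
      ∀ k : ℕ, ‖hurwitzDefect s (n + 1) (a + k)‖ ≤
        C * A ^ (2 - (s.re + (n + 1))) * (1 / ((k : ℝ) + 1) ^ 2) := by
  obtain ⟨C, hC0, hC⟩ := exists_norm_hurwitzDefect_le n
  refine ⟨C * (∏ i ∈ Finset.range (n + 1), (|M| + i)) * Real.exp (Real.pi * |M|) *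
    c ^ (-(M + (n + 1))), by positivity, fun s hs hsM hq a ha A hA hA2 k => ?_⟩
  have hAk : 0 < A + k := by positivity
  have hM : ‖s‖ ≤ |M| := hsM.trans (le_abs_self M)
  refine (hC s hs (by linarith) (a + k) (add_natCast_mem_slitPlane ha k) (c * (A + k))
    (by positivity) fun t ht => ?_).trans ?_
  · have := hA2 (k + t) (by positivity)
    push_cast at this
    rw [add_assoc]
    refine le_trans ?_ this
    gcongr
    linarith
  have h1 : (c * (A + k)) ^ (-(s.re + (n + 1))) ≤
      c ^ (-(M + (n + 1))) * (A ^ (2 - (s.re + (n + 1))) * (1 / ((k : ℝ) + 1) ^ 2)) := by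
    rw [Real.mul_rpow hc.le hAk.le]
    have h2 : c ^ (-(s.re + (n + 1))) ≤ c ^ (-(M + (n + 1))) := by
      apply Real.rpow_le_rpow_of_exponent_ge hc hc1
      have := (Complex.re_le_norm s).trans hsM
      linarith
    have h3 : (A + k) ^ (-(s.re + (n + 1))) = (A + k) ^ (2 - (s.re + (n + 1))) *
        (1 / (A + k) ^ 2) := by
      rw [show -(s.re + (n + 1 : ℝ)) = (2 - (s.re + (n + 1))) - (2 : ℕ) by push_cast; ring,
        Real.rpow_sub_natCast hAk.ne']
      ring
    rw [h3]
    have h4 : (A + k) ^ (2 - (s.re + (n + 1))) ≤ A ^ (2 - (s.re + (n + 1))) :=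
      Real.rpow_le_rpow_of_nonpos (by linarith) (by simp) (by linarith)
    have h5 : 1 / (A + k) ^ 2 ≤ 1 / ((k : ℝ) + 1) ^ 2 := by
      gcongr 1 / ?_ ^ 2
      linarith
    gcongr
  have h6 : (∏ i ∈ Finset.range (n + 1), ‖s + i‖) ≤ ∏ i ∈ Finset.range (n + 1), (|M| + i) := by
    refine Finset.prod_le_prod (fun _ _ => norm_nonneg _) fun i _ => ?_
    refine (norm_add_le _ _).trans ?_
    rw [Complex.norm_natCast]
    gcongr
  have h7 : |s.im| ≤ |M| := (Complex.abs_im_le_norm s).trans hM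
  calc _ ≤ C * (∏ i ∈ Finset.range (n + 1), (|M| + i)) * Real.exp (Real.pi * |M|) *
        (c ^ (-(M + (n + 1))) * (A ^ (2 - (s.re + (n + 1))) * (1 / ((k : ℝ) + 1) ^ 2))) := by
        gcongr
    _ = _ := by ring

lemma summable_one_div_natCast_add_one_sq : Summable fun k : ℕ => 1 / ((k : ℝ) + 1) ^ 2 := by
  have := (summable_nat_add_iff 1).2 (Real.summable_one_div_nat_pow.2 one_lt_two)
  simpa using this

/-- The hypothesis keeps `a` away from the negative axis: `cos (arg a) ≥ -κ`. Then `‖a + r‖² ≥ ‖a‖²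
+ r² - 2κr‖a‖`, and the right side equals `(1-κ)/2 · (‖a‖ + r)² + (1+κ)/2 · (‖a‖ - r)²`. -/
lemma sqrt_mul_le_norm_add_ofReal {κ : ℝ} (h1 : -1 ≤ κ) (hκ : κ ≤ 1) {a : ℂ}
    (ha : -(κ * ‖a‖) ≤ a.re) {r : ℝ} (hr : 0 ≤ r) : √((1 - κ) / 2) * (‖a‖ + r) ≤ ‖a + r‖ := by
  apply abs_le_of_sq_le_sq' _ (norm_nonneg _) |>.2
  have hn : ‖a‖ ^ 2 = a.re ^ 2 + a.im ^ 2 := by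
    rw [← Complex.normSq_eq_norm_sq, Complex.normSq_apply]; ring
  have hn' : ‖a + r‖ ^ 2 = (a.re + r) ^ 2 + a.im ^ 2 := by
    rw [← Complex.normSq_eq_norm_sq, Complex.normSq_apply]; simp; ring
  rw [mul_pow, Real.sq_sqrt (by linarith), hn']
  nlinarith [mul_nonneg (show 0 ≤ 1 + κ by linarith) (sq_nonneg (‖a‖ - r)),
    mul_nonneg hr (sub_nonneg.2 ha), norm_nonneg a]

/-- Around a point of the slit plane, `‖a + r‖` grows linearly in `r ≥ 0`, uniformly. -/
lemma exists_nhds_forall_mul_le_norm_add_ofReal {a₀ : ℂ} (ha₀ : a₀ ∈ Complex.slitPlane) :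
    ∃ U : Set ℂ, IsOpen U ∧ a₀ ∈ U ∧ U ⊆ Complex.slitPlane ∧ ∃ c : ℝ, 0 < c ∧ c ≤ 1 ∧
      ∀ a ∈ U, ∀ r : ℝ, 0 ≤ r → c * (1 + r) ≤ ‖a + r‖ := by
  have h0 : 0 < ‖a₀‖ := norm_pos_iff.2 (Complex.slitPlane_ne_zero ha₀)
  have hlt : -a₀.re < ‖a₀‖ := by
    rcases (Complex.mem_slitPlane_iff.1 ha₀) with h | h
    · linarith
    · have := (Complex.abs_re_lt_norm (z := a₀)).2 h
      exact (neg_le_abs _).trans_lt this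
  -- The midpoint of `-cos (arg a₀)` and `1`: the cone condition is strict at `a₀`, hence open, and
  -- still excludes the cut.
  set κ : ℝ := (1 - a₀.re / ‖a₀‖) / 2 with hκ
  have hκ1 : κ < 1 := by
    have : -(a₀.re / ‖a₀‖) < 1 := by rw [← neg_div, div_lt_one h0]; exact hlt
    rw [hκ]; linarith
  have hκ0 : 0 ≤ κ := by
    have : a₀.re / ‖a₀‖ ≤ 1 := by rw [div_le_one h0]; exact Complex.re_le_norm a₀
    rw [hκ]; linarith
  have hsq : 0 < √((1 - κ) / 2) := Real.sqrt_pos.2 (by linarith)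
  refine ⟨{a | -(κ * ‖a‖) < a.re} ∩ {a | ‖a₀‖ / 2 < ‖a‖}, ?_, ⟨?_, ?_⟩, ?_,
    √((1 - κ) / 2) * min 1 (‖a₀‖ / 2), by positivity, ?_, ?_⟩
  · exact (isOpen_lt (by fun_prop) Complex.continuous_re).inter
      (isOpen_lt continuous_const continuous_norm)
  · have : κ * ‖a₀‖ = (‖a₀‖ - a₀.re) / 2 := by rw [hκ]; field_simp
    simp only [Set.mem_ofPred_eq, this]
    linarith
  · simp only [Set.mem_ofPred_eq]; linarith
  · rintro a ⟨h1, h2⟩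
    simp only [Set.mem_ofPred_eq] at h1 h2
    by_contra hcon
    rw [Complex.mem_slitPlane_iff, not_or, not_lt, not_not] at hcon
    have : ‖a‖ = -a.re := by
      rw [← abs_of_nonpos hcon.1]
      exact ((Complex.abs_re_eq_norm).2 hcon.2).symm
    have ha : 0 < ‖a‖ := by linarith
    nlinarith
  · refine mul_le_one₀ ?_ (by positivity) (min_le_left _ _)
    exact Real.sqrt_le_one.2 (by linarith)
  · rintro a ⟨h1, h2⟩ r hr
    simp only [Set.mem_ofPred_eq] at h1 h2
    refine le_trans ?_ (sqrt_mul_le_norm_add_ofReal (by linarith) hκ1.le h1.le hr)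
    rw [mul_assoc]
    gcongr
    have h3 : min 1 (‖a₀‖ / 2) ≤ 1 := min_le_left _ _
    have h4 : min 1 (‖a₀‖ / 2) ≤ ‖a₀‖ / 2 := min_le_right _ _
    nlinarith

lemma summable_hurwitzDefect {s : ℂ} (hs : s ≠ 1) {n : ℕ} (hn : 2 ≤ s.re + (n + 1)) {a : ℂ}
    (ha : a ∈ Complex.slitPlane) :
    Summable fun k : ℕ => hurwitzDefect s (n + 1) (a + k) := by
  obtain ⟨U, -, haU, -, c, hc, hc1, hU⟩ := exists_nhds_forall_mul_le_norm_add_ofReal ha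
  obtain ⟨C, -, hC⟩ := exists_norm_hurwitzDefect_add_natCast_le n ‖s‖ c hc hc1
  exact Summable.of_norm_bounded (summable_one_div_natCast_add_one_sq.mul_left _)
    (hC s hs le_rfl hn a ha 1 le_rfl (hU a haU))

/-! ### Telescoping of the defects and independence of the order. -/

lemma sum_range_hurwitzDefect (s : ℂ) (n : ℕ) (a : ℂ) (N : ℕ) :
    ∑ k ∈ Finset.range N, hurwitzDefect s n (a + k) =
      ∑ k ∈ Finset.range N, (a + k) ^ (-s) - hurwitzApprox s n a + hurwitzApprox s n (a + N) := by
  induction N with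
  | zero => simp
  | succ N ih =>
    rw [Finset.sum_range_succ, ih, Finset.sum_range_succ, hurwitzDefect]
    push_cast
    rw [add_assoc a]
    ring

lemma tendsto_norm_add_natCast (a : ℂ) :
    Tendsto (fun N : ℕ => ‖a + N‖) atTop atTop := by
  refine tendsto_atTop_mono (f := fun N : ℕ => (N : ℝ) - ‖a‖) (fun N => ?_)
    (tendsto_atTop_add_const_right _ _ tendsto_natCast_atTop_atTop)
  have := norm_sub_norm_le (N : ℂ) (-a)
  rwa [Complex.norm_natCast, norm_neg, sub_neg_eq_add, add_comm (N : ℂ)] at this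

lemma tendsto_hurwitzTerm {s : ℂ} {j : ℕ} (hj : 1 - s.re - j < 0) (a : ℂ) :
    Tendsto (fun N : ℕ => hurwitzTerm s j (a + N)) atTop (𝓝 0) := by
  have h1 : Tendsto (fun N : ℕ => (a + N) ^ (1 - s - j)) atTop (𝓝 0) := by
    rw [tendsto_zero_iff_norm_tendsto_zero]
    refine squeeze_zero (fun _ => norm_nonneg _) (fun N => norm_cpow_le_mul_exp _ _) ?_
    have h2 : (1 - s - (j : ℂ)).re = -(-(1 - s.re - j)) := by simp
    have h3 := ((tendsto_rpow_neg_atTop (y := -(1 - s.re - j)) (by linarith)).comp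
      (tendsto_norm_add_natCast a)).mul_const (Real.exp (Real.pi * |(1 - s - (j : ℂ)).im|))
    rw [zero_mul] at h3
    simpa only [h2, Function.comp_def] using h3
  simpa [hurwitzTerm] using h1.const_mul ((-1) ^ j * (∏ i ∈ Finset.range j, (s - 1 + i)))

/-- The Euler–Maclaurin summation formula of order `n + 1`, as a limit. -/
lemma tendsto_sum_add_hurwitzApprox {s : ℂ} (hs : s ≠ 1) {n : ℕ} (hn : 2 ≤ s.re + (n + 1)) {a : ℂ}
    (ha : a ∈ Complex.slitPlane) :
    Tendsto (fun N : ℕ => ∑ k ∈ Finset.range N, (a + k) ^ (-s) + hurwitzApprox s (n + 1) (a + N))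
      atTop (𝓝 (hurwitzApprox s (n + 1) a + ∑' k : ℕ, hurwitzDefect s (n + 1) (a + k))) := by
  have h := (summable_hurwitzDefect hs hn ha).hasSum.tendsto_sum_nat.const_add
    (hurwitzApprox s (n + 1) a)
  refine h.congr fun N => ?_
  rw [sum_range_hurwitzDefect]
  ring

lemma hurwitzApprox_sub_hurwitzApprox (s : ℂ) {n m : ℕ} (hnm : n ≤ m) (a : ℂ) :
    hurwitzApprox s m a - hurwitzApprox s n a = 1 / (s - 1) *
      ∑ j ∈ Finset.Ico (n + 1) (m + 1),
        ((bernoulli j : ℚ) : ℂ) / (j.factorial : ℂ) * hurwitzTerm s j a := by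
  rw [Finset.sum_Ico_eq_sub _ (by omega), hurwitzApprox, hurwitzApprox]
  ring

/-- The extra terms have index `j ≥ n + 2`, so they are powers of `a + N` whose exponent has
negative real part. This is why the order chosen in `hurwitz` does not affect its value. -/
lemma tendsto_hurwitzApprox_sub {s : ℂ} {n m : ℕ} (hn : 2 ≤ s.re + (n + 1)) (hnm : n ≤ m) (a : ℂ) :
    Tendsto (fun N : ℕ => hurwitzApprox s (m + 1) (a + N) - hurwitzApprox s (n + 1) (a + N))
      atTop (𝓝 0) := by
  simp only [hurwitzApprox_sub_hurwitzApprox s (Nat.add_le_add_right hnm 1)]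
  rw [← mul_zero (1 / (s - 1))]
  refine Tendsto.const_mul _ ?_
  rw [show (0 : ℂ) = ∑ j ∈ Finset.Ico (n + 1 + 1) (m + 1 + 1), (0 : ℂ) by simp]
  refine tendsto_finsetSum _ fun j hj => ?_
  rw [← mul_zero (((bernoulli j : ℚ) : ℂ) / (j.factorial : ℂ))]
  refine Tendsto.const_mul _ (tendsto_hurwitzTerm ?_ a)
  have : ((n + 1 + 1 : ℕ) : ℝ) ≤ j := by exact_mod_cast (Finset.mem_Ico.1 hj).1
  push_cast at this
  linarith

/-- Justifies the order `⌈‖s‖⌉₊ + 2` in `hurwitz`: the decay exponent of the defect is then at least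
2. -/
lemma two_le_re_add_ceil_norm (s : ℂ) : 2 ≤ s.re + (((⌈‖s‖⌉₊ + 1 : ℕ) : ℝ) + 1) := by
  have h1 := Nat.le_ceil ‖s‖
  have h2 := (abs_le.1 (Complex.abs_re_le_norm s)).1
  push_cast
  linarith

lemma tendsto_sum_add_hurwitzApprox_hurwitz {s : ℂ} (hs : s ≠ 1) {n : ℕ} (hn : 2 ≤ s.re + (n + 1))
    {a : ℂ} (ha : a ∈ Complex.slitPlane) :
    Tendsto (fun N : ℕ => ∑ k ∈ Finset.range N, (a + k) ^ (-s) + hurwitzApprox s (n + 1) (a + N))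
      atTop (𝓝 (hurwitz s a)) := by
  have h2 : Tendsto (fun N : ℕ => ∑ k ∈ Finset.range N, (a + k) ^ (-s) +
      hurwitzApprox s (⌈‖s‖⌉₊ + 1 + 1) (a + N)) atTop (𝓝 (hurwitz s a)) :=
    tendsto_sum_add_hurwitzApprox hs (two_le_re_add_ceil_norm s) ha
  rcases le_total n (⌈‖s‖⌉₊ + 1) with h | h
  · have h3 := h2.sub (tendsto_hurwitzApprox_sub hn h a)
    rw [sub_zero] at h3
    exact h3.congr fun N => by ring
  · have h3 := h2.add (tendsto_hurwitzApprox_sub (two_le_re_add_ceil_norm s) h a)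
    rw [add_zero] at h3
    exact h3.congr fun N => by ring

lemma hurwitz_eq_hurwitzApprox_add_tsum {s : ℂ} (hs : s ≠ 1) {n : ℕ} (hn : 2 ≤ s.re + (n + 1))
    {a : ℂ} (ha : a ∈ Complex.slitPlane) :
    hurwitz s a = hurwitzApprox s (n + 1) a + ∑' k : ℕ, hurwitzDefect s (n + 1) (a + k) :=
  tendsto_nhds_unique (tendsto_sum_add_hurwitzApprox_hurwitz hs hn ha)
    (tendsto_sum_add_hurwitzApprox hs hn ha)

/-- For `Re s > 1` the function `hurwitz` is the sum of the Hurwitz series. -/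
lemma tendsto_sum_hurwitz {s : ℂ} (hs : 1 < s.re) {a : ℂ} (ha : a ∈ Complex.slitPlane) :
    Tendsto (fun N : ℕ => ∑ k ∈ Finset.range N, (a + k) ^ (-s)) atTop (𝓝 (hurwitz s a)) := by
  have hs1 : s ≠ 1 := by rintro rfl; simp at hs
  have h1 := tendsto_sum_add_hurwitzApprox_hurwitz hs1 (n := 0) (by simp; linarith) ha
  have h2 : Tendsto (fun N : ℕ => hurwitzApprox s (0 + 1) (a + N)) atTop (𝓝 0) := by
    have h3 := ((tendsto_hurwitzTerm (s := s) (j := 0) (by simpa using hs) a).add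
      ((tendsto_hurwitzTerm (s := s) (j := 1) (by simp; linarith) a).const_mul
        (-1 / 2))).const_mul (1 / (s - 1))
    simp only [mul_zero, add_zero] at h3
    refine h3.congr fun N => ?_
    simp [hurwitzApprox, Finset.sum_range_succ]
  have h4 := h1.sub h2
  rw [sub_zero] at h4
  exact h4.congr fun N => by ring

/-! ### Holomorphy in each variable. -/

lemma differentiableAt_hurwitzApprox_left {s : ℂ} (hs : s ≠ 1) (n : ℕ) {a : ℂ} (ha : a ≠ 0) :
    DifferentiableAt ℂ (fun s => hurwitzApprox s n a) s := by
  have hs' : s - 1 ≠ 0 := sub_ne_zero.2 hs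
  unfold hurwitzApprox
  refine DifferentiableAt.mul (by fun_prop (disch := assumption)) ?_
  refine DifferentiableAt.fun_sum fun j _ => ?_
  refine DifferentiableAt.const_mul ?_ _
  unfold hurwitzTerm
  refine DifferentiableAt.mul (DifferentiableAt.const_mul ?_ _) ?_
  · exact DifferentiableAt.fun_finsetProd fun i _ => by fun_prop
  · exact DifferentiableAt.const_cpow (by fun_prop) (Or.inl ha)

lemma differentiableAt_hurwitzApprox (s : ℂ) (n : ℕ) {a : ℂ} (ha : a ∈ Complex.slitPlane) :
    DifferentiableAt ℂ (fun a => hurwitzApprox s n a) a := by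
  unfold hurwitzApprox
  refine DifferentiableAt.const_mul (DifferentiableAt.fun_sum fun j _ => ?_) _
  exact (hasDerivAt_hurwitzTerm s j ha).differentiableAt.const_mul _

lemma differentiableAt_hurwitzDefect_left {s : ℂ} (hs : s ≠ 1) (n : ℕ) {a : ℂ}
    (ha : a ∈ Complex.slitPlane) : DifferentiableAt ℂ (fun s => hurwitzDefect s n a) s := by
  unfold hurwitzDefect
  refine (DifferentiableAt.sub ?_ ?_).add ?_
  · exact DifferentiableAt.const_cpow (by fun_prop) (Or.inl (Complex.slitPlane_ne_zero ha))
  · exact differentiableAt_hurwitzApprox_left hs n (Complex.slitPlane_ne_zero ha)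
  · refine differentiableAt_hurwitzApprox_left hs n (Complex.slitPlane_ne_zero ?_)
    simpa using add_natCast_mem_slitPlane ha 1

lemma differentiableAt_hurwitzDefect (s : ℂ) (n : ℕ) {a : ℂ} (ha : a ∈ Complex.slitPlane) :
    DifferentiableAt ℂ (fun a => hurwitzDefect s n a) a := by
  unfold hurwitzDefect
  refine (DifferentiableAt.sub ?_ (differentiableAt_hurwitzApprox s n ha)).add ?_
  · exact DifferentiableAt.cpow_const (by fun_prop) ha
  · have h1 : a + 1 ∈ Complex.slitPlane := by simpa using add_natCast_mem_slitPlane ha 1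
    exact DifferentiableAt.comp a (g := fun a => hurwitzApprox s n a) (f := fun a => a + 1)
      (differentiableAt_hurwitzApprox s n h1) (by fun_prop)

lemma differentiableAt_hurwitz_right {s : ℂ} (hs : s ≠ 1) {a : ℂ} (ha : a ∈ Complex.slitPlane) :
    DifferentiableAt ℂ (fun a => hurwitz s a) a := by
  obtain ⟨U, hUo, haU, hUs, c, hc, hc1, hU⟩ := exists_nhds_forall_mul_le_norm_add_ofReal ha
  have hn := two_le_re_add_ceil_norm s
  obtain ⟨C, -, hC⟩ := exists_norm_hurwitzDefect_add_natCast_le (⌈‖s‖⌉₊ + 1) ‖s‖ c hc hc1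
  have h := Complex.differentiableOn_tsum_of_summable_norm
    (F := fun (k : ℕ) (a : ℂ) => hurwitzDefect s (⌈‖s‖⌉₊ + 1 + 1) (a + k))
    (summable_one_div_natCast_add_one_sq.mul_left _) (fun k b hb => ?_) hUo
    (fun k b hb => hC s hs le_rfl hn b (hUs hb) 1 le_rfl (hU b hb) k)
  · exact (differentiableAt_hurwitzApprox s _ ha).add (h.differentiableAt (hUo.mem_nhds haU))
  · have h1 := differentiableAt_hurwitzDefect s (⌈‖s‖⌉₊ + 1 + 1)
      (add_natCast_mem_slitPlane (hUs hb) k)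
    exact (DifferentiableAt.comp b (g := fun a => hurwitzDefect s (⌈‖s‖⌉₊ + 1 + 1) a)
      (f := fun b => b + (k : ℂ)) h1 (by fun_prop)).differentiableWithinAt

/-- The order in the definition of `hurwitz` jumps with `‖s‖`. One fixed order, admissible on a
whole unit ball around `s`, represents the same function there, and its series converges uniformly.
-/
lemma differentiableAt_hurwitz_left {s : ℂ} (hs : s ≠ 1) {a : ℂ} (ha : a ∈ Complex.slitPlane) :
    DifferentiableAt ℂ (fun s => hurwitz s a) s := by
  obtain ⟨U, -, haU, -, c, hc, hc1, hU⟩ := exists_nhds_forall_mul_le_norm_add_ofReal ha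
  obtain ⟨n, hn⟩ := exists_nat_ge (‖s‖ + 2)
  obtain ⟨C, hC0, hC⟩ := exists_norm_hurwitzDefect_add_natCast_le n (‖s‖ + 1) c hc hc1
  set V : Set ℂ := Metric.ball s 1 ∩ {1}ᶜ with hV
  have hVo : IsOpen V := Metric.isOpen_ball.inter isOpen_compl_singleton
  have hsV : s ∈ V := ⟨Metric.mem_ball_self one_pos, hs⟩
  have hnorm : ∀ w ∈ V, ‖w‖ ≤ ‖s‖ + 1 := by
    intro w hw
    have h1 : ‖w - s‖ < 1 := by simpa [dist_eq_norm] using hw.1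
    have h2 := norm_add_le (w - s) s
    rw [sub_add_cancel] at h2
    linarith
  have hre : ∀ w ∈ V, 2 ≤ w.re + (n + 1) := by
    intro w hw
    have h1 := (abs_le.1 (Complex.abs_re_le_norm w)).1
    have h2 := hnorm w hw
    linarith
  have h := Complex.differentiableOn_tsum_of_summable_norm
    (F := fun (k : ℕ) (s : ℂ) => hurwitzDefect s (n + 1) (a + k))
    (u := fun k : ℕ => C * (1 / ((k : ℝ) + 1) ^ 2))
    (summable_one_div_natCast_add_one_sq.mul_left _)
    (fun k w hw => (differentiableAt_hurwitzDefect_left hw.2 _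
      (add_natCast_mem_slitPlane ha k)).differentiableWithinAt) hVo
    (fun k w hw => by simpa using hC w hw.2 (hnorm w hw) (hre w hw) a ha 1 le_rfl (hU a haU) k)
  have h2 := (differentiableAt_hurwitzApprox_left hs (n + 1) (Complex.slitPlane_ne_zero ha)).add
    (h.differentiableAt (hVo.mem_nhds hsV))
  refine h2.congr_of_eventuallyEq ?_
  filter_upwards [hVo.mem_nhds hsV] with w hw
  exact hurwitz_eq_hurwitzApprox_add_tsum hw.2 (hre w hw) ha

/-- The Euler–Maclaurin expansion of the Hurwitz zeta function holds uniformly in sectors. -/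
lemma exists_norm_hurwitz_sub_hurwitzApprox_le {μ : ℝ} (hμ : μ ≠ 1) {κ : ℝ} (hκ0 : -1 ≤ κ)
    (hκ : κ < 1) (K : ℕ) :
    ∃ C : ℝ, ∀ a ∈ Complex.slitPlane, 1 ≤ ‖a‖ → -(κ * ‖a‖) ≤ a.re →
      ‖hurwitz μ a - hurwitzApprox μ (2 * K + 1) a‖ ≤ C * ‖a‖ ^ (-(μ + 2 * K + 1)) := by
  have hs : (μ : ℂ) ≠ 1 := by exact_mod_cast hμ
  -- The summand `|μ|` makes the defects summable; `n ≥ 2K + 2` makes the tail no larger than the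
  -- first omitted power.
  obtain ⟨n, hn⟩ := exists_nat_ge (|μ| + 2 * K + 2)
  have hn1 : 2 ≤ (μ : ℂ).re + (n + 1) := by
    have h1 := neg_abs_le μ
    have h2 : (0 : ℝ) ≤ K := by positivity
    rw [Complex.ofReal_re]
    linarith
  have hnK : (2 * K + 2 : ℝ) ≤ n := by linarith [abs_nonneg μ]
  have hnK' : 2 * K + 2 ≤ n := by exact_mod_cast hnK
  have hc : 0 < √((1 - κ) / 2) := Real.sqrt_pos.2 (by linarith)
  have hc1 : √((1 - κ) / 2) ≤ 1 := Real.sqrt_le_one.2 (by linarith)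
  obtain ⟨C, hC0, hC⟩ := exists_norm_hurwitzDefect_add_natCast_le n ‖(μ : ℂ)‖ _ hc hc1
  -- `D` bounds the coefficients of the terms between the two orders. They start at `j = 2K + 2`,
  -- whose exponent `1 - μ - j` is exactly `-(μ + 2K + 1)`.
  set D : ℝ := ‖1 / ((μ : ℂ) - 1)‖ * ∑ j ∈ Finset.Ico (2 * K + 1 + 1) (n + 1 + 1),
    ‖((bernoulli j : ℚ) : ℂ) / (j.factorial : ℂ)‖ * ‖∏ i ∈ Finset.range j, ((μ : ℂ) - 1 + i)‖
  refine ⟨C * (∑' k : ℕ, 1 / ((k : ℝ) + 1) ^ 2) + D, fun a ha ha1 har => ?_⟩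
  have hpos : 0 < ‖a‖ := by linarith
  have htail : ‖∑' k : ℕ, hurwitzDefect μ (n + 1) (a + k)‖ ≤
      C * (∑' k : ℕ, 1 / ((k : ℝ) + 1) ^ 2) * ‖a‖ ^ (-(μ + 2 * K + 1)) := by
    have h1 := tsum_of_norm_bounded
      (summable_one_div_natCast_add_one_sq.hasSum.mul_left
        (C * ‖a‖ ^ (2 - ((μ : ℂ).re + (n + 1)))))
      (hC μ hs le_rfl hn1 a ha ‖a‖ ha1 fun r hr => sqrt_mul_le_norm_add_ofReal hκ0 hκ.le har hr)
    refine h1.trans ?_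
    have h2 : ‖a‖ ^ (2 - ((μ : ℂ).re + (n + 1))) ≤ ‖a‖ ^ (-(μ + 2 * K + 1)) := by
      apply Real.rpow_le_rpow_of_exponent_le ha1
      rw [Complex.ofReal_re]
      linarith
    have h3 : 0 ≤ ∑' k : ℕ, 1 / ((k : ℝ) + 1) ^ 2 := tsum_nonneg fun k => by positivity
    calc _ ≤ C * ‖a‖ ^ (-(μ + 2 * K + 1)) * (∑' k : ℕ, 1 / ((k : ℝ) + 1) ^ 2) := by gcongr
      _ = _ := by ring
  have hhead : ‖hurwitzApprox μ (n + 1) a - hurwitzApprox μ (2 * K + 1) a‖ ≤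
      D * ‖a‖ ^ (-(μ + 2 * K + 1)) := by
    rw [hurwitzApprox_sub_hurwitzApprox _ (by omega), norm_mul]
    simp only [D]
    rw [mul_assoc, Finset.sum_mul]
    gcongr
    refine (norm_sum_le _ _).trans (Finset.sum_le_sum fun j hj => ?_)
    rw [norm_mul, mul_assoc]
    gcongr
    rw [hurwitzTerm, norm_mul, norm_mul, norm_pow, norm_neg, norm_one, one_pow, one_mul]
    gcongr
    have h1 : (1 - (μ : ℂ) - j) = ((1 - μ - j : ℝ) : ℂ) := by push_cast; ring
    rw [h1, Complex.norm_cpow_real]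
    apply Real.rpow_le_rpow_of_exponent_le ha1
    have : ((2 * K + 1 + 1 : ℕ) : ℝ) ≤ j := by exact_mod_cast (Finset.mem_Ico.1 hj).1
    push_cast at this
    linarith
  rw [hurwitz_eq_hurwitzApprox_add_tsum hs hn1 ha, add_sub_right_comm, add_mul]
  refine (norm_add_le _ _).trans ?_
  rw [add_comm]
  exact add_le_add htail hhead

/-! ### The two finite expansions as `hurwitzApprox`. -/

lemma sum_range_bernoulli (f : ℕ → ℂ) (K : ℕ) :
    ∑ j ∈ Finset.range (2 * K + 1 + 1), ((bernoulli j : ℚ) : ℂ) / (j.factorial : ℂ) * f j =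
      f 0 - 1 / 2 * f 1 + ∑ k ∈ Finset.Icc 1 K,
        ((bernoulli (2 * k) : ℚ) : ℂ) / ((2 * k).factorial : ℂ) * f (2 * k) := by
  induction K with
  | zero => simp [Finset.sum_range_succ]; ring
  | succ K ih =>
    -- Stopping at the odd index `2K + 1` includes `B₁` even for `K = 0`, and costs nothing later
    -- because the other odd Bernoulli numbers vanish.
    rw [show 2 * (K + 1) + 1 + 1 = (2 * K + 1 + 1) + 1 + 1 by ring, Finset.sum_range_succ,
      Finset.sum_range_succ, ih, Finset.sum_Icc_succ_top (by omega),
      bernoulli_eq_zero_of_odd (n := 2 * K + 1 + 1 + 1) ⟨K + 1, by ring⟩ (by omega),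
      show 2 * (K + 1) = 2 * K + 1 + 1 by ring]
    push_cast
    ring

lemma expansionFactored_eq_hurwitzApprox (μ : ℝ) (hμ : μ ≠ 1) (K : ℕ) {z : ℂ} (hz : z + 1 ≠ 0) :
    expansionFactored μ K z =
      -Complex.exp (Complex.I * Real.pi * μ) * hurwitzApprox μ (2 * K + 1) (z + 1) := by
  have hs : (μ : ℂ) - 1 ≠ 0 := sub_ne_zero.2 (by exact_mod_cast hμ)
  have hp : ∀ j : ℕ, (z + 1) ^ (1 - (μ : ℂ) - j) =
      1 / (z + 1) ^ ((μ : ℂ) - 1) * (1 / (z + 1) ^ j) := by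
    intro j
    rw [Complex.cpow_sub _ _ hz, Complex.cpow_natCast, show 1 - (μ : ℂ) = -(μ - 1) by ring,
      Complex.cpow_neg]
    field_simp
  rw [hurwitzApprox, sum_range_bernoulli, expansionFactored]
  simp only [hurwitzTerm, hp]
  simp only [Even.neg_pow (even_two_mul _), one_pow, one_mul]
  set P := 1 / (z + 1) ^ ((μ : ℂ) - 1)
  have hsum : ∑ k ∈ Finset.Icc 1 K, ((bernoulli (2 * k) : ℚ) : ℂ) / ((2 * k).factorial : ℂ) *
      ((∏ i ∈ Finset.range (2 * k), ((μ : ℂ) - 1 + i)) * (P * (1 / (z + 1) ^ (2 * k)))) =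
      P * ∑ k ∈ Finset.Icc 1 K,
          (∏ i ∈ Finset.range (2 * k), ((μ : ℂ) - 1 + i)) * ((bernoulli (2 * k) : ℚ) : ℂ)
            / (((2 * k).factorial : ℂ) * (z + 1) ^ (2 * k)) := by
    rw [Finset.mul_sum]
    refine Finset.sum_congr rfl fun k _ => ?_
    have : ((2 * k).factorial : ℂ) ≠ 0 := by exact_mod_cast (Nat.factorial_pos _).ne'
    field_simp
  rw [hsum]
  simp
  field_simp
  ring

lemma expansionSum_eq_hurwitzApprox (μ : ℝ) (hμ : μ ≠ 1) (K : ℕ) (z : ℂ) :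
    expansionSum μ K z =
      -Complex.exp (Complex.I * Real.pi * μ) * hurwitzApprox μ (2 * K + 1) (z + 1) := by
  have hs : (μ : ℂ) - 1 ≠ 0 := sub_ne_zero.2 (by exact_mod_cast hμ)
  have he : ∀ k : ℕ, Complex.exp (Complex.I * Real.pi * (μ + 2 * k - 1)) =
      -Complex.exp (Complex.I * Real.pi * μ) := by
    intro k
    rw [show Complex.I * Real.pi * (μ + 2 * k - 1) = Complex.I * Real.pi * μ +
      k * (2 * Real.pi * Complex.I) - Real.pi * Complex.I by ring, Complex.exp_sub, Complex.exp_add,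
      Complex.exp_nat_mul_two_pi_mul_I, Complex.exp_pi_mul_I]
    ring
  have he0 := he 0
  simp only [Nat.cast_zero, mul_zero, add_zero] at he0
  rw [hurwitzApprox, sum_range_bernoulli, expansionSum, mul_add, mul_add, Finset.mul_sum,
    Finset.mul_sum, he0]
  congr 1
  · simp only [hurwitzTerm]
    rw [show (1 : ℂ) / (z + 1) ^ ((μ : ℂ) - 1) = (z + 1) ^ (1 - (μ : ℂ)) by
        rw [one_div, ← Complex.cpow_neg, neg_sub],
      show (1 : ℂ) / (z + 1) ^ (μ : ℂ) = (z + 1) ^ (-(μ : ℂ)) by rw [one_div, ← Complex.cpow_neg]]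
    simp
    field_simp
    ring
  · refine Finset.sum_congr rfl fun k hk => ?_
    have hk1 : 1 ≤ k := (Finset.mem_Icc.1 hk).1
    rw [he, hurwitzTerm, Even.neg_pow (even_two_mul _), one_pow, one_mul,
      show (1 : ℂ) / (z + 1) ^ ((μ : ℂ) + 2 * k - 1) = (z + 1) ^ (1 - (μ : ℂ) - (2 * k : ℕ)) by
        rw [one_div, ← Complex.cpow_neg]; congr 1; push_cast; ring]
    have h2 : ∏ i ∈ Finset.range (2 * k), ((μ : ℂ) - 1 + i) =
        (∏ i ∈ Finset.range (2 * k - 1), ((μ : ℂ) + i)) * (μ - 1) := by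
      obtain ⟨m, hm⟩ : ∃ m, 2 * k = m + 1 := ⟨2 * k - 1, by omega⟩
      rw [hm, Finset.prod_range_succ', Nat.add_sub_cancel]
      congr 1
      · refine Finset.prod_congr rfl fun i _ => ?_
        push_cast; ring
      · simp
    rw [h2]
    field_simp

open MeasureTheory

/-! ### Power kernels with a pole off the real axis -/

lemma ofReal_sub_mem_slitPlane {w : ℂ} (hw : w.im ≠ 0) (v : ℝ) : (v : ℂ) - w ∈ Complex.slitPlane := by
  rw [Complex.mem_slitPlane_iff]
  right
  simpa using hw

lemma one_add_abs_le_mul_norm_sub {w : ℂ} (hw : w.im ≠ 0) (v : ℝ) :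
    1 + |v| ≤ (1 + (1 + ‖w‖) / |w.im|) * ‖(v : ℂ) - w‖ := by
  have h0 : 0 < |w.im| := abs_pos.2 hw
  have h1 : |w.im| ≤ ‖(v : ℂ) - w‖ := by
    have := Complex.abs_im_le_norm ((v : ℂ) - w)
    simpa using this
  have h2 : |v| ≤ ‖(v : ℂ) - w‖ + ‖w‖ := by
    have := norm_add_le ((v : ℂ) - w) w
    simpa using this
  have h3 : 1 + ‖w‖ ≤ (1 + ‖w‖) / |w.im| * ‖(v : ℂ) - w‖ := by
    rw [div_mul_eq_mul_div, le_div_iff₀ h0]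
    gcongr
  linarith

lemma norm_ofReal_sub_cpow_le {w : ℂ} (hw : w.im ≠ 0) {q : ℝ} (hq : 0 ≤ q) (v : ℝ) :
    ‖((v : ℂ) - w) ^ ((-q : ℝ) : ℂ)‖ ≤
      (1 + (1 + ‖w‖) / |w.im|) ^ q * (1 + |v|) ^ (-q) := by
  rw [Complex.norm_cpow_real]
  have h0 : 0 < |w.im| := abs_pos.2 hw
  have hB : 0 < 1 + (1 + ‖w‖) / |w.im| := by positivity
  have h1 := one_add_abs_le_mul_norm_sub hw v
  have h2 : 0 < ‖(v : ℂ) - w‖ := by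
    rw [norm_pos_iff]; exact Complex.slitPlane_ne_zero (ofReal_sub_mem_slitPlane hw v)
  have h3 := Real.rpow_le_rpow_of_nonpos (by positivity) h1 (neg_nonpos.2 hq)
  rw [Real.mul_rpow hB.le h2.le, Real.rpow_neg hB.le] at h3
  have h4 : 0 < (1 + (1 + ‖w‖) / |w.im|) ^ q := Real.rpow_pos_of_pos hB q
  calc _ = (1 + (1 + ‖w‖) / |w.im|) ^ q * (((1 + (1 + ‖w‖) / |w.im|) ^ q)⁻¹ *
        ‖(v : ℂ) - w‖ ^ (-q)) := by field_simp
    _ ≤ _ := by gcongr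

lemma continuous_ofReal_sub_cpow {w : ℂ} (hw : w.im ≠ 0) (c : ℂ) :
    Continuous fun v : ℝ => ((v : ℂ) - w) ^ c :=
  continuous_iff_continuousAt.2 fun v =>
    ContinuousAt.cpow (by fun_prop) continuousAt_const (ofReal_sub_mem_slitPlane hw v)

lemma integrable_ofReal_sub_cpow {w : ℂ} (hw : w.im ≠ 0) {q : ℝ} (hq : 1 < q) :
    Integrable fun v : ℝ => ((v : ℂ) - w) ^ ((-q : ℝ) : ℂ) := by
  have h : Integrable fun v : ℝ => (1 + ‖v‖) ^ (-q) :=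
    integrable_one_add_norm (by simpa using hq)
  exact (h.const_mul _).mono' (continuous_ofReal_sub_cpow hw _).aestronglyMeasurable
    (ae_of_all _ fun v => norm_ofReal_sub_cpow_le hw (by linarith) v)

lemma tendsto_ofReal_sub_cpow {w : ℂ} {q : ℝ} (hq : 0 < q) :
    Tendsto (fun v : ℝ => ((v : ℂ) - w) ^ ((-q : ℝ) : ℂ)) (cocompact ℝ) (𝓝 0) := by
  rw [tendsto_zero_iff_norm_tendsto_zero]
  simp only [Complex.norm_cpow_real]
  refine (tendsto_rpow_neg_atTop hq).comp ?_
  refine tendsto_atTop_mono (f := fun v : ℝ => ‖v‖ - ‖w‖) (fun v => ?_)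
    (tendsto_atTop_add_const_right _ _ (tendsto_norm_cocompact_atTop (E := ℝ)))
  have := norm_sub_norm_le (v : ℂ) w
  rwa [Complex.norm_real] at this

lemma hasDerivAt_ofReal_sub_cpow {w : ℂ} (hw : w.im ≠ 0) {q : ℝ} (hq : q ≠ 1) (v : ℝ) :
    HasDerivAt (fun v : ℝ => ((v : ℂ) - w) ^ ((-(q - 1) : ℝ) : ℂ) / ((1 - q : ℝ) : ℂ))
      (((v : ℂ) - w) ^ ((-q : ℝ) : ℂ)) v := by
  have h1 : HasDerivAt (fun z : ℂ => (z - w) ^ ((-(q - 1) : ℝ) : ℂ))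
      (((-(q - 1) : ℝ) : ℂ) * ((v : ℂ) - w) ^ (((-(q - 1) : ℝ) : ℂ) - 1) * 1) v :=
    ((hasDerivAt_id (v : ℂ)).sub_const w).cpow_const (ofReal_sub_mem_slitPlane hw v)
  refine (h1.comp_ofReal.div_const _).congr_deriv ?_
  have h2 : ((1 - q : ℝ) : ℂ) ≠ 0 := by exact_mod_cast sub_ne_zero.2 hq.symm
  rw [show ((-(q - 1) : ℝ) : ℂ) - 1 = ((-q : ℝ) : ℂ) by push_cast; ring, neg_sub, mul_one,
    mul_div_cancel_left₀ _ h2]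

lemma tendsto_ofReal_sub_cpow_div {w : ℂ} {q : ℝ} (hq : 1 < q) :
    Tendsto (fun v : ℝ => ((v : ℂ) - w) ^ ((-(q - 1) : ℝ) : ℂ) / ((1 - q : ℝ) : ℂ)) (cocompact ℝ)
      (𝓝 0) := by
  simpa using (tendsto_ofReal_sub_cpow (w := w) (sub_pos.2 hq)).div_const ((1 - q : ℝ) : ℂ)

/-- The line `v - w` avoids the cut of the principal power, so the power has a global antiderivative
along it, which vanishes at both ends. -/
lemma integral_ofReal_sub_cpow {w : ℂ} (hw : w.im ≠ 0) {q : ℝ} (hq : 1 < q) :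
    ∫ v : ℝ, ((v : ℂ) - w) ^ ((-q : ℝ) : ℂ) = 0 := by
  rw [integral_of_hasDerivAt_of_tendsto (hasDerivAt_ofReal_sub_cpow hw hq.ne')
    (integrable_ofReal_sub_cpow hw hq)
    ((tendsto_ofReal_sub_cpow_div hq).mono_left atBot_le_cocompact)
    ((tendsto_ofReal_sub_cpow_div hq).mono_left atTop_le_cocompact), sub_zero]

lemma integral_Iic_ofReal_sub_cpow {w : ℂ} (hw : w.im ≠ 0) {q : ℝ} (hq : 1 < q) :
    ∫ v : ℝ in Set.Iic 0, ((v : ℂ) - w) ^ ((-q : ℝ) : ℂ) =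
      (-w) ^ ((-(q - 1) : ℝ) : ℂ) / ((1 - q : ℝ) : ℂ) := by
  rw [integral_Iic_of_hasDerivAt_of_tendsto' (fun v _ => hasDerivAt_ofReal_sub_cpow hw hq.ne' v)
    (integrable_ofReal_sub_cpow hw hq).integrableOn
    ((tendsto_ofReal_sub_cpow_div hq).mono_left atBot_le_cocompact), sub_zero]
  simp

lemma ofReal_mul_ofReal_sub_cpow {w : ℂ} (hw : w.im ≠ 0) (q v : ℝ) :
    (v : ℂ) * ((v : ℂ) - w) ^ ((-q : ℝ) : ℂ) =
      ((v : ℂ) - w) ^ ((-(q - 1) : ℝ) : ℂ) + w * ((v : ℂ) - w) ^ ((-q : ℝ) : ℂ) := by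
  have h0 := Complex.slitPlane_ne_zero (ofReal_sub_mem_slitPlane hw v)
  rw [show ((-(q - 1) : ℝ) : ℂ) = ((-q : ℝ) : ℂ) + 1 by push_cast; ring, Complex.cpow_add _ _ h0,
    Complex.cpow_one]
  ring

lemma integrable_ofReal_mul_ofReal_sub_cpow {w : ℂ} (hw : w.im ≠ 0) {q : ℝ} (hq : 2 < q) :
    Integrable fun v : ℝ => (v : ℂ) * ((v : ℂ) - w) ^ ((-q : ℝ) : ℂ) := by
  simp only [ofReal_mul_ofReal_sub_cpow hw]
  exact (integrable_ofReal_sub_cpow hw (by linarith)).add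
    ((integrable_ofReal_sub_cpow hw (by linarith)).const_mul w)

/-- Writing `v = (v - w) + w` reduces the first moment to two pure powers. This removes the linear
parts of the Weierstrass terms. -/
lemma integral_ofReal_mul_ofReal_sub_cpow {w : ℂ} (hw : w.im ≠ 0) {q : ℝ} (hq : 2 < q) :
    ∫ v : ℝ, (v : ℂ) * ((v : ℂ) - w) ^ ((-q : ℝ) : ℂ) = 0 := by
  simp only [ofReal_mul_ofReal_sub_cpow hw]
  rw [integral_add (integrable_ofReal_sub_cpow hw (by linarith))
    ((integrable_ofReal_sub_cpow hw (by linarith)).const_mul w), integral_const_mul,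
    integral_ofReal_sub_cpow hw (by linarith), integral_ofReal_sub_cpow hw (by linarith)]
  simp

/-! ### The Cauchy theorem in the lower half plane -/

/-- The integral over a horizontal line of a function that is holomorphic below it vanishes if the
function decays faster than `1 / z`. -/
lemma integral_lowerHalfPlane_eq_zero {f : ℂ → ℂ} (hf : DifferentiableOn ℂ f {z | z.im < 0})
    {C p : ℝ} (hp : 1 < p) (hC : ∀ z : ℂ, z.im < 0 → 1 ≤ ‖z‖ → ‖f z‖ ≤ C * ‖z‖ ^ (-p))
    {η : ℝ} (hη : 0 < η) (hint : Integrable fun v : ℝ => f (v - η * Complex.I)) :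
    ∫ v : ℝ, f (v - η * Complex.I) = 0 := by
  have hC0 : 0 ≤ C := by
    have h := (norm_nonneg _).trans (hC (-Complex.I) (by simp) (by simp))
    simpa using h
  have hlim := intervalIntegral_tendsto_integral hint tendsto_neg_atTop_atBot tendsto_id
  refine tendsto_nhds_unique hlim ?_
  rw [tendsto_zero_iff_norm_tendsto_zero]
  have hsq : Tendsto (fun R : ℝ => 4 * C * R ^ (-(p - 1))) atTop (𝓝 0) := by
    simpa using (tendsto_rpow_neg_atTop (sub_pos.2 hp)).const_mul (4 * C)
  refine squeeze_zero' (Eventually.of_forall fun _ => norm_nonneg _) ?_ hsq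
  filter_upwards [eventually_ge_atTop 1] with R hR
  have hR0 : 0 < R := by linarith
  have hbound : ∀ z : ℂ, z.im < 0 → R ≤ ‖z‖ → ‖f z‖ ≤ C * R ^ (-p) := by
    intro z hz hzR
    refine (hC z hz (hR.trans hzR)).trans ?_
    gcongr ?_ * ?_
    exact Real.rpow_le_rpow_of_nonpos hR0 hzR (by linarith)
  -- The rectangle hangs from the line `Im z = -η` with width `2R` and height `R`. Its other three
  -- sides lie at distance at least `R` from 0 and have total length `4R`, whence the constant `4 *
  -- C`.
  have hrect := Complex.integral_boundary_rect_eq_zero_of_differentiableOn f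
    (⟨-R, -η⟩ : ℂ) (⟨R, -η - R⟩ : ℂ) (hf.mono fun z hz => ?_)
  swap
  · have h2 := hz.2
    simp only [Set.mem_preimage] at h2
    rw [Set.uIcc_of_ge (by linarith)] at h2
    change z.im < 0
    linarith [h2.2]
  simp only at hrect
  have h1 : ‖∫ x : ℝ in (-R)..R, f (x + ((-η - R : ℝ) : ℂ) * Complex.I)‖ ≤
      C * R ^ (-p) * |R - -R| := by
    refine intervalIntegral.norm_integral_le_of_norm_le_const fun x _ => hbound _ ?_ ?_
    · simp; linarith
    · have := Complex.abs_im_le_norm ((x : ℂ) + ((-η - R : ℝ) : ℂ) * Complex.I)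
      have h3 : ((x : ℂ) + ((-η - R : ℝ) : ℂ) * Complex.I).im = -η - R := by simp
      rw [h3] at this
      linarith [neg_le_abs (-η - R)]
  have hvert : ∀ r : ℝ, |r| = R →
      ‖∫ y : ℝ in (-η)..(-η - R), f ((r : ℂ) + y * Complex.I)‖ ≤
        C * R ^ (-p) * |-η - R - -η| := by
    intro r hr
    refine intervalIntegral.norm_integral_le_of_norm_le_const fun y hy => hbound _ ?_ ?_
    · rw [Set.uIoc_of_ge (by linarith)] at hy
      simp; linarith [hy.2]
    · have := Complex.abs_re_le_norm ((r : ℂ) + y * Complex.I)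
      simpa [hr] using this
  have h2 := hvert R (abs_of_pos hR0)
  have h3 := hvert (-R) (by rw [abs_neg, abs_of_pos hR0])
  have hR1 : |R - -R| = 2 * R := by rw [abs_of_pos (by linarith)]; ring
  have hR2 : |-η - R - -η| = R := by rw [abs_of_neg (by linarith)]; ring
  rw [hR1] at h1
  rw [hR2] at h2 h3
  have hmain : ∫ x : ℝ in (-R)..R, f (x - η * Complex.I) =
      (∫ x : ℝ in (-R)..R, f (x + ((-η - R : ℝ) : ℂ) * Complex.I))
      - Complex.I • (∫ y : ℝ in (-η)..(-η - R), f ((R : ℂ) + y * Complex.I))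
      + Complex.I • (∫ y : ℝ in (-η)..(-η - R), f (((-R : ℝ) : ℂ) + y * Complex.I)) := by
    have h4 : ∀ x : ℝ, (x : ℂ) - η * Complex.I = x + ((-η : ℝ) : ℂ) * Complex.I := by
      intro x; push_cast; ring
    simp only [h4]
    linear_combination hrect
  simp only [id]
  rw [hmain]
  refine (norm_add_le _ _).trans ((add_le_add_left (norm_sub_le _ _) _).trans ?_)
  rw [norm_smul, norm_smul, Complex.norm_I, one_mul, one_mul]
  have h5 : R ^ (-(p - 1)) = R ^ (-p) * R := by
    rw [show -(p - 1) = -p + 1 by ring, Real.rpow_add_one hR0.ne']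
  rw [h5]
  linarith

/-! ### The logarithmic potential of a power kernel -/

lemma norm_log_le (z : ℂ) : ‖Complex.log z‖ ≤ |Real.log ‖z‖| + Real.pi := by
  refine (Complex.norm_le_abs_re_add_abs_im _).trans ?_
  rw [Complex.log_re, Complex.log_im]
  gcongr
  exact Complex.abs_arg_le_pi z

lemma norm_le_mul_norm_sub {w z : ℂ} (hw : 0 < w.im) (hz : z.im ≤ 0) :
    ‖z‖ ≤ (1 + ‖w‖ / w.im) * ‖z - w‖ := by
  have h1 : w.im ≤ ‖z - w‖ := by
    have := (neg_le_abs _).trans (Complex.abs_im_le_norm (z - w))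
    simp only [Complex.sub_im] at this
    linarith
  have h2 : ‖z‖ ≤ ‖z - w‖ + ‖w‖ := by
    have := norm_add_le (z - w) w
    simpa using this
  have h3 : ‖w‖ ≤ ‖w‖ / w.im * ‖z - w‖ := by
    rw [div_mul_eq_mul_div, le_div_iff₀ hw]
    gcongr
  linarith

lemma mem_slitPlane_of_im_neg {z : ℂ} (hz : z.im < 0) : z ∈ Complex.slitPlane :=
  Complex.mem_slitPlane_iff.2 (Or.inr hz.ne)

/-- From below, the argument tends to `-π` on the negative axis; `Real.log v` means `log |v|`. -/
lemma tendsto_log_ofReal_sub_mul_I {v : ℝ} (hv : v ≠ 0) :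
    Tendsto (fun η : ℝ => Complex.log (v - η * Complex.I)) (𝓝[>] 0)
      (𝓝 ((Real.log v : ℂ) - if v ≤ 0 then Real.pi * Complex.I else 0)) := by
  have hc : Tendsto (fun η : ℝ => (v : ℂ) - η * Complex.I) (𝓝[>] 0) (𝓝 v) := by
    have : Tendsto (fun η : ℝ => (v : ℂ) - η * Complex.I) (𝓝 0) (𝓝 ((v : ℂ) - (0 : ℝ) * Complex.I)) :=
      Continuous.tendsto (by fun_prop) 0
    simpa using this.mono_left nhdsWithin_le_nhds
  rcases lt_or_gt_of_ne hv with h | h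
  · rw [if_pos h.le]
    have h1 := Complex.tendsto_log_nhdsWithin_im_neg_of_re_neg_of_im_zero (z := (v : ℂ))
      (by simpa using h) (by simp)
    rw [Complex.norm_real, Real.norm_eq_abs, Real.log_abs] at h1
    refine h1.comp (tendsto_nhdsWithin_iff.2 ⟨hc, ?_⟩)
    filter_upwards [self_mem_nhdsWithin] with η hη
    have : (0 : ℝ) < η := hη
    simpa using this
  · rw [if_neg (not_le.2 h), sub_zero, Complex.ofReal_log h.le]
    exact (continuousAt_clog (Complex.ofReal_mem_slitPlane.2 h)).tendsto.comp hc

/-- A bound free of `η`, for dominated convergence as the contour rises to the real axis. -/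
lemma abs_log_norm_sub_mul_I_le {v η : ℝ} (hv : v ≠ 0) (hη : |η| ≤ 1) :
    |Real.log ‖(v : ℂ) - η * Complex.I‖| ≤ |Real.log v| + |v| := by
  have h1 : |v| ≤ ‖(v : ℂ) - η * Complex.I‖ := by
    have := Complex.abs_re_le_norm ((v : ℂ) - η * Complex.I)
    simpa using this
  have h2 : ‖(v : ℂ) - η * Complex.I‖ ≤ |v| + 1 := by
    refine (norm_sub_le _ _).trans ?_
    simpa using hη
  have hv0 : 0 < |v| := abs_pos.2 hv
  have hpos : 0 < ‖(v : ℂ) - η * Complex.I‖ := hv0.trans_le h1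
  rw [abs_le]
  constructor
  · have := Real.log_le_log hv0 h1
    rw [Real.log_abs] at this
    linarith [neg_abs_le (Real.log v)]
  · have := Real.log_le_sub_one_of_pos hpos
    linarith [abs_nonneg (Real.log v)]

/-- The logarithmic potential of `(v - w) ^ (-(μ + 1))` for `w` in the upper half plane. -/
lemma integral_log_mul_ofReal_sub_cpow {w : ℂ} (hw : 0 < w.im) {μ : ℝ} (hμ : 1 < μ)
    (hint : Integrable fun v : ℝ => (Real.log v : ℂ) * ((v : ℂ) - w) ^ ((-(μ + 1) : ℝ) : ℂ)) :
    ∫ v : ℝ, (Real.log v : ℂ) * ((v : ℂ) - w) ^ ((-(μ + 1) : ℝ) : ℂ) =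
      -(Real.pi * Complex.I / μ) * (-w) ^ ((-μ : ℝ) : ℂ) := by
  have hw' : w.im ≠ 0 := hw.ne'
  set F : ℝ → ℂ := fun v => ((v : ℂ) - w) ^ ((-(μ + 1) : ℝ) : ℂ) with hF
  have hFint : Integrable F := integrable_ofReal_sub_cpow hw' (by linarith)
  have hvF := integrable_ofReal_mul_ofReal_sub_cpow hw' (q := μ + 1) (by linarith)
  set f : ℂ → ℂ := fun z => Complex.log z * (z - w) ^ ((-(μ + 1) : ℝ) : ℂ) with hf
  have hfd : DifferentiableOn ℂ f {z | z.im < 0} := by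
    intro z hz
    have hz : z.im < 0 := hz
    refine (DifferentiableAt.mul ?_ ?_).differentiableWithinAt
    · exact Complex.differentiableAt_log (mem_slitPlane_of_im_neg hz)
    · refine DifferentiableAt.cpow_const (by fun_prop) (mem_slitPlane_of_im_neg ?_)
      simp only [Complex.sub_im]; linarith
  have hB : 0 < 1 + ‖w‖ / w.im := by positivity
  have hdecay : ∀ z : ℂ, z.im < 0 → 1 ≤ ‖z‖ →
      ‖f z‖ ≤ ((1 + Real.pi) * (1 + ‖w‖ / w.im) ^ (μ + 1)) * ‖z‖ ^ (-μ) := by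
    intro z hz hz1
    have hz0 : 0 < ‖z‖ := by linarith
    have h1 : ‖Complex.log z‖ ≤ (1 + Real.pi) * ‖z‖ := by
      refine (norm_log_le z).trans ?_
      rw [abs_of_nonneg (Real.log_nonneg hz1)]
      have := Real.log_le_sub_one_of_pos hz0
      nlinarith [Real.pi_pos]
    have h2 := norm_le_mul_norm_sub hw hz.le
    have h3 : 0 < ‖z - w‖ := by
      by_contra hcon
      have : ‖z - w‖ = 0 := le_antisymm (not_lt.1 hcon) (norm_nonneg _)
      rw [this] at h2
      linarith
    have h4 := Real.rpow_le_rpow_of_nonpos hz0 h2 (z := -(μ + 1)) (by linarith)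
    rw [Real.mul_rpow hB.le h3.le, Real.rpow_neg hB.le] at h4
    have h5 : 0 < (1 + ‖w‖ / w.im) ^ (μ + 1) := Real.rpow_pos_of_pos hB _
    have h6 : ‖z - w‖ ^ (-(μ + 1)) ≤ (1 + ‖w‖ / w.im) ^ (μ + 1) * ‖z‖ ^ (-(μ + 1)) := by
      calc _ = (1 + ‖w‖ / w.im) ^ (μ + 1) * (((1 + ‖w‖ / w.im) ^ (μ + 1))⁻¹ *
          ‖z - w‖ ^ (-(μ + 1))) := by field_simp
        _ ≤ _ := by gcongr
    have h7 : ‖z‖ ^ (-μ) = ‖z‖ * ‖z‖ ^ (-(μ + 1)) := by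
      rw [show -μ = -(μ + 1) + 1 by ring, Real.rpow_add_one hz0.ne']; ring
    rw [hf]
    simp only [norm_mul, Complex.norm_cpow_real]
    calc _ ≤ (1 + Real.pi) * ‖z‖ * ((1 + ‖w‖ / w.im) ^ (μ + 1) * ‖z‖ ^ (-(μ + 1))) := by gcongr
      _ = _ := by rw [h7]; ring
  set b : ℝ → ℝ := fun v => ‖(Real.log v : ℂ) * F v‖ + ‖(v : ℂ) * F v‖ + Real.pi * ‖F v‖ with hb
  have hbint : Integrable b := (hint.norm.add hvF.norm).add (hFint.norm.const_mul _)
  have hbound : ∀ η : ℝ, 0 < η → η ≤ 1 → ∀ v : ℝ, v ≠ 0 → ‖f (v - η * Complex.I)‖ ≤ b v := by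
    intro η hη hη1 v hv
    have h1 := norm_log_le (v - η * Complex.I)
    have h2 := abs_log_norm_sub_mul_I_le hv (η := η) (by rwa [abs_of_pos hη])
    -- Moving down from the real axis moves away from `w`, so the kernel only gets smaller.
    have h3 : ‖(v : ℂ) - w‖ ≤ ‖(v : ℂ) - η * Complex.I - w‖ := by
      apply abs_le_of_sq_le_sq' _ (norm_nonneg _) |>.2
      rw [← Complex.normSq_eq_norm_sq, ← Complex.normSq_eq_norm_sq, Complex.normSq_apply,
        Complex.normSq_apply]
      simp
      nlinarith
    have h4 : 0 < ‖(v : ℂ) - w‖ :=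
      norm_pos_iff.2 (Complex.slitPlane_ne_zero (ofReal_sub_mem_slitPlane hw' v))
    have h5 := Real.rpow_le_rpow_of_nonpos h4 h3 (z := -(μ + 1)) (by linarith)
    simp only [hf, hb, hF, norm_mul, Complex.norm_cpow_real, Complex.norm_real, Real.norm_eq_abs]
    calc _ ≤ (|Real.log v| + |v| + Real.pi) * ‖(v : ℂ) - w‖ ^ (-(μ + 1)) := by
          gcongr
          linarith
      _ = _ := by ring
  have hcont : ∀ η : ℝ, 0 < η → Continuous fun v : ℝ => f (v - η * Complex.I) := by
    intro η hη
    refine continuous_iff_continuousAt.2 fun v => ?_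
    have him : ((v : ℂ) - η * Complex.I).im < 0 := by simpa using hη
    have h1 : ContinuousAt f ((v : ℂ) - η * Complex.I) :=
      (hfd.differentiableAt ((isOpen_lt Complex.continuous_im continuous_const).mem_nhds
        him)).continuousAt
    exact ContinuousAt.comp (f := fun v : ℝ => (v : ℂ) - η * Complex.I) h1 (by fun_prop)
  have hne : ∀ᵐ v : ℝ, v ≠ 0 := by
    simp [ae_iff]
  have hzero : ∀ η : ℝ, 0 < η → η ≤ 1 → ∫ v : ℝ, f (v - η * Complex.I) = 0 := by
    intro η hη hη1
    refine integral_lowerHalfPlane_eq_zero hfd hμ hdecay hη ?_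
    refine hbint.mono' (hcont η hη).aestronglyMeasurable ?_
    filter_upwards [hne] with v hv using hbound η hη hη1 v hv
  have hsmall : ∀ᶠ η : ℝ in 𝓝[>] 0, 0 < η ∧ η ≤ 1 := by
    filter_upwards [Ioc_mem_nhdsGT (zero_lt_one (α := ℝ))] with η hη using hη
  have hlim : Tendsto (fun η : ℝ => ∫ v : ℝ, f (v - η * Complex.I)) (𝓝[>] 0)
      (𝓝 (∫ v : ℝ, ((Real.log v : ℂ) - if v ≤ 0 then Real.pi * Complex.I else 0) * F v)) := by
    refine tendsto_integral_filter_of_dominated_convergence b ?_ ?_ hbint ?_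
    · filter_upwards [hsmall] with η hη using (hcont η hη.1).aestronglyMeasurable
    · filter_upwards [hsmall] with η hη
      filter_upwards [hne] with v hv using hbound η hη.1 hη.2 v hv
    · filter_upwards [hne] with v hv
      refine (tendsto_log_ofReal_sub_mul_I hv).mul ?_
      have h1 : ContinuousAt (fun η : ℝ => ((v : ℂ) - η * Complex.I - w) ^ ((-(μ + 1) : ℝ) : ℂ)) 0 := by
        refine ContinuousAt.cpow (by fun_prop) continuousAt_const ?_
        simpa using ofReal_sub_mem_slitPlane hw' v
      have h2 := h1.tendsto.mono_left (nhdsWithin_le_nhds (s := Set.Ioi 0))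
      simpa [hF] using h2
  have h0 : ∫ v : ℝ, ((Real.log v : ℂ) - if v ≤ 0 then Real.pi * Complex.I else 0) * F v = 0 := by
    refine tendsto_nhds_unique hlim (tendsto_const_nhds.congr' ?_)
    filter_upwards [hsmall] with η hη using (hzero η hη.1 hη.2).symm
  -- The jump `-πi` turns the vanishing integral into an identity between the logarithmic integral
  -- and `πi` times the integral of `F` over the negative half line.
  have hind : ∀ v : ℝ, ((Real.log v : ℂ) - if v ≤ 0 then Real.pi * Complex.I else 0) * F v =
      (Real.log v : ℂ) * F v - (Set.Iic (0 : ℝ)).indicator (fun v => Real.pi * Complex.I * F v) v := by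
    intro v
    by_cases hv : v ≤ 0
    · rw [Set.indicator_of_mem (Set.mem_Iic.2 hv), if_pos hv]; ring
    · rw [Set.indicator_of_notMem (by simpa using hv), if_neg hv, sub_zero, sub_zero]
  simp only [hind] at h0
  rw [integral_sub hint ((hFint.const_mul _).indicator measurableSet_Iic),
    integral_indicator measurableSet_Iic, integral_const_mul,
    integral_Iic_ofReal_sub_cpow hw' (by linarith), sub_eq_zero] at h0
  rw [h0, add_sub_cancel_right, show (1 : ℝ) - (μ + 1) = -μ by ring]
  push_cast
  ring

/-! ### The Weierstrass product of `Γ` on the real line -/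

lemma abs_sub_log_one_add_le {u : ℝ} (hu : |u| ≤ 1 / 2) : |u - Real.log (1 + u)| ≤ 2 * u ^ 2 := by
  have h := Real.abs_log_sub_add_sum_range_le (x := -u) (by rw [abs_neg]; linarith) 1
  simp only [Finset.sum_range_one, zero_add, pow_one, abs_neg, sub_neg_eq_add, Nat.cast_zero,
    div_one] at h
  rw [abs_sub_comm, sub_eq_neg_add]
  refine h.trans ?_
  rw [one_add_one_eq_two, sq_abs, div_le_iff₀ (by linarith)]
  nlinarith [sq_nonneg u]

lemma abs_sub_log_one_add_le_of_not_mem_Icc {u : ℝ} (hu : 1 / 2 ≤ |u|)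
    (hu' : u ∉ Set.Icc (-2) (-1 / 2)) : |u - Real.log (1 + u)| ≤ 2 * |u| := by
  have h1 : 1 ≤ |1 + u| := by
    rw [Set.mem_Icc, not_and_or, not_le, not_le] at hu'
    rw [le_abs]
    rcases le_abs.1 hu with h | h
    · left; linarith
    · right
      rcases hu' with h' | h'
      · linarith
      · linarith
  have h2 : 0 ≤ Real.log (1 + u) := by
    rw [← Real.log_abs]; exact Real.log_nonneg h1
  have h3 : Real.log (1 + u) ≤ |u| := by
    rw [← Real.log_abs]
    have h4 := Real.log_le_sub_one_of_pos (x := |1 + u|) (by linarith)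
    have h5 := abs_add_le 1 u
    rw [abs_one] at h5
    linarith
  refine (abs_sub _ _).trans ?_
  rw [abs_of_nonneg h2]
  linarith

lemma intervalIntegrable_abs_rpow {r : ℝ} (hr : -1 < r) (b : ℝ) (hb : 0 ≤ b) :
    IntervalIntegrable (fun u : ℝ => |u| ^ r) volume (-b) b := by
  have h1 : IntervalIntegrable (fun u : ℝ => |u| ^ r) volume 0 b := by
    refine (intervalIntegral.intervalIntegrable_rpow' hr).congr fun u hu => ?_
    rw [Set.uIoc_of_le hb] at hu
    simp only [abs_of_pos hu.1]
  have h2 : IntervalIntegrable (fun u : ℝ => |u| ^ r) volume (-0) (-b) := by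
    simpa using (IntervalIntegrable.iff_comp_neg (by simp)).1 h1
  rw [neg_zero] at h2
  exact h2.symm.trans h1

/-- At 0 the first factor is `O(u²)`, which needs `p < 2`; at infinity it is `O(|u|)`, which needs
`p > 1`. In between there is only the integrable logarithmic singularity at `u = -1`. -/
lemma integrable_abs_sub_log_one_add_mul_rpow {p : ℝ} (hp : 1 < p) (hp2 : p < 2) :
    Integrable fun u : ℝ => |u - Real.log (1 + u)| * |u| ^ (-(p + 1)) := by
  have hmeas : Measurable fun u : ℝ => |u - Real.log (1 + u)| * |u| ^ (-(p + 1)) := by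
    fun_prop
  have h1 : IntegrableOn (fun u : ℝ => |u - Real.log (1 + u)| * |u| ^ (-(p + 1)))
      (Set.Icc (-(1 / 2)) (1 / 2)) := by
    have hi := (intervalIntegrable_iff_integrableOn_Icc_of_le (by norm_num)).1
      (intervalIntegrable_abs_rpow (r := 1 - p) (by linarith) (1 / 2) (by norm_num))
    refine (hi.const_mul 2).mono' hmeas.aestronglyMeasurable ?_
    refine (ae_restrict_iff' measurableSet_Icc).2 (ae_of_all _ fun u hu => ?_)
    rw [Real.norm_of_nonneg (by positivity)]
    rcases eq_or_ne u 0 with rfl | hu0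
    · simp
      exact Real.rpow_nonneg le_rfl _
    · have hu1 : 0 < |u| := abs_pos.2 hu0
      have h2 := abs_sub_log_one_add_le (u := u) (abs_le.2 hu)
      have h3 : |u| ^ (1 - p) = u ^ 2 * |u| ^ (-(p + 1)) := by
        rw [show 1 - p = -(p + 1) + (2 : ℕ) by push_cast; ring, Real.rpow_add_natCast hu1.ne', sq_abs]
        ring
      rw [h3, ← mul_assoc]
      gcongr
  have h2 : IntegrableOn (fun u : ℝ => |u - Real.log (1 + u)| * |u| ^ (-(p + 1)))
      (Set.Icc (-2) (-1 / 2)) := by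
    have hl : IntervalIntegrable (fun u : ℝ => Real.log (1 + u)) volume (-2) (-1 / 2) := by
      have := (intervalIntegral.intervalIntegrable_log' (a := -1) (b := 1 / 2)).comp_add_left 1
      norm_num at this
      norm_num
      exact this
    have hi := (intervalIntegrable_iff_integrableOn_Icc_of_le (by norm_num)).1
      (((continuous_id.intervalIntegrable (-2 : ℝ) (-1 / 2)).sub hl).abs.mul_const ((1 / 2 : ℝ) ^ (-(p + 1))))
    refine hi.mono' hmeas.aestronglyMeasurable ?_
    refine (ae_restrict_iff' measurableSet_Icc).2 (ae_of_all _ fun u hu => ?_)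
    rw [Real.norm_of_nonneg (by positivity)]
    have hu1 : 1 / 2 ≤ |u| := by rw [le_abs]; right; linarith [hu.2]
    have := Real.rpow_le_rpow_of_nonpos (by norm_num) hu1 (z := -(p + 1)) (by linarith)
    simp only [id]
    gcongr
  have h3 : IntegrableOn (fun u : ℝ => |u - Real.log (1 + u)| * |u| ^ (-(p + 1)))
      (Set.Icc (-(1 / 2)) (1 / 2) ∪ Set.Icc (-2) (-1 / 2))ᶜ := by
    have hj : Integrable fun v : ℝ => (1 + ‖v‖) ^ (-p) :=
      integrable_one_add_norm (by simpa using hp)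
    refine (hj.integrableOn.const_mul (2 * (1 / 3) ^ (-p))).mono' hmeas.aestronglyMeasurable ?_
    refine (ae_restrict_iff' (measurableSet_Icc.union measurableSet_Icc).compl).2
      (ae_of_all _ fun u hu => ?_)
    rw [Set.mem_compl_iff, Set.mem_union, not_or] at hu
    have hu1 : 1 / 2 < |u| := by
      by_contra hcon
      exact hu.1 (abs_le.1 (not_lt.1 hcon))
    rw [Real.norm_of_nonneg (by positivity)]
    have h4 := abs_sub_log_one_add_le_of_not_mem_Icc hu1.le hu.2
    have h5 : |u| ^ (-p) = |u| * |u| ^ (-(p + 1)) := by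
      rw [show -p = -(p + 1) + 1 by ring, Real.rpow_add_one (by positivity)]; ring
    have h6 : |u| ^ (-p) ≤ (1 / 3) ^ (-p) * (1 + ‖u‖) ^ (-p) := by
      rw [← Real.mul_rpow (by norm_num) (by positivity)]
      refine Real.rpow_le_rpow_of_nonpos (by positivity) ?_ (by linarith)
      rw [Real.norm_eq_abs]
      linarith
    calc _ ≤ 2 * |u| * |u| ^ (-(p + 1)) := by gcongr
      _ = 2 * |u| ^ (-p) := by rw [h5]; ring
      _ ≤ 2 * ((1 / 3) ^ (-p) * (1 + ‖u‖) ^ (-p)) := by gcongr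
      _ = _ := by ring
  rw [← integrableOn_univ, ← Set.union_compl_self (Set.Icc (-(1 / 2 : ℝ)) (1 / 2) ∪ Set.Icc (-2) (-1 / 2))]
  exact (h1.union h2).union h3

/-- The summands of the logarithm of the Weierstrass product of `Γ(y + 1)`. -/
noncomputable def logGammaTerm : ℕ → ℝ → ℝ
  | 0, y => -Real.eulerMascheroniConstant * y
  | k + 1, y => y / ((k : ℝ) + 1) - Real.log (1 + y / ((k : ℝ) + 1))

lemma sum_range_logGammaTerm {y : ℝ} (hy : ∀ k : ℕ, y + k ≠ 0) {n : ℕ} (hn : n ≠ 0) :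
    ∑ k ∈ Finset.range n, logGammaTerm (k + 1) y =
      Real.log |Real.GammaSeq y n| + Real.log y + y * ((harmonic n : ℝ) - Real.log n) := by
  have hn0 : (0 : ℝ) < n := by exact_mod_cast Nat.pos_of_ne_zero hn
  have hy0 : y ≠ 0 := by simpa using hy 0
  have hprod : ∏ j ∈ Finset.range (n + 1), (y + j) ≠ 0 :=
    Finset.prod_ne_zero_iff.2 fun j _ => hy j
  have h1 : Real.log |Real.GammaSeq y n| = y * Real.log n + Real.log (n.factorial : ℝ)
      - Real.log (∏ j ∈ Finset.range (n + 1), (y + j)) := by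
    rw [Real.log_abs, Real.GammaSeq, Real.log_div _ hprod, Real.log_mul, Real.log_rpow hn0]
    · exact (Real.rpow_pos_of_pos hn0 y).ne'
    · exact_mod_cast n.factorial_ne_zero
    · exact mul_ne_zero (Real.rpow_pos_of_pos hn0 y).ne' (by exact_mod_cast n.factorial_ne_zero)
  have h2 : ∀ m : ℕ, ∑ k ∈ Finset.range m, logGammaTerm (k + 1) y =
      Real.log (m.factorial : ℝ) - Real.log (∏ j ∈ Finset.range (m + 1), (y + j)) + Real.log y
        + y * (harmonic m : ℝ) := by
    intro m
    induction m with
    | zero => simp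
    | succ m ih =>
      have hm : ((m : ℝ) + 1) ≠ 0 := by positivity
      have hp : ∏ j ∈ Finset.range (m + 1), (y + j) ≠ 0 :=
        Finset.prod_ne_zero_iff.2 fun j _ => hy j
      have hym : y + (m + 1 : ℝ) ≠ 0 := by simpa using hy (m + 1)
      rw [Finset.sum_range_succ, ih, Finset.prod_range_succ _ (m + 1), Real.log_mul hp (hy _),
        Nat.factorial_succ, harmonic_succ, logGammaTerm]
      push_cast
      rw [Real.log_mul hm (by exact_mod_cast m.factorial_ne_zero),
        show 1 + y / ((m : ℝ) + 1) = (y + (m + 1)) / (m + 1) by field_simp; ring,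
        Real.log_div hym hm]
      field_simp
      ring
  rw [h1, h2]
  ring

lemma summable_logGammaTerm (y : ℝ) : Summable fun k : ℕ => logGammaTerm (k + 1) y := by
  refine Summable.of_norm_bounded_eventually_nat
    (summable_one_div_natCast_add_one_sq.mul_left (2 * y ^ 2)) ?_
  obtain ⟨N, hN⟩ := exists_nat_ge (2 * |y|)
  filter_upwards [eventually_ge_atTop N] with k hk
  have hk' : (N : ℝ) ≤ k := by exact_mod_cast hk
  have hk0 : (0 : ℝ) < (k : ℝ) + 1 := by positivity
  rw [Real.norm_eq_abs, logGammaTerm]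
  refine (abs_sub_log_one_add_le ?_).trans_eq ?_
  · rw [abs_div, abs_of_pos hk0, div_le_iff₀ hk0]
    linarith
  · field_simp

/-- Euler's limit for `Γ` together with `H_n - log n → γ`; the term of index 0 cancels the resulting
`γ y`. The excluded points `0, -1, -2, …` form a null set. -/
lemma hasSum_logGammaTerm {y : ℝ} (hy : ∀ k : ℕ, y + k ≠ 0) :
    HasSum (fun n => logGammaTerm n y) (Real.log ‖Complex.Gamma ((y : ℂ) + 1)‖) := by
  have hy0 : y ≠ 0 := by simpa using hy 0
  have hG : Real.Gamma y ≠ 0 := Real.Gamma_ne_zero fun m hm => hy m (by rw [hm]; ring)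
  have hval : Real.log ‖Complex.Gamma ((y : ℂ) + 1)‖ = Real.log |Real.Gamma y| + Real.log y := by
    rw [show (y : ℂ) + 1 = ((y + 1 : ℝ) : ℂ) by push_cast; rfl, Complex.Gamma_ofReal,
      Complex.norm_real, Real.norm_eq_abs, Real.log_abs, Real.log_abs, Real.Gamma_add_one hy0,
      Real.log_mul hy0 hG]
    ring
  have hlim : Tendsto (fun n : ℕ => ∑ k ∈ Finset.range n, logGammaTerm (k + 1) y) atTop
      (𝓝 (Real.log |Real.Gamma y| + Real.log y + y * Real.eulerMascheroniConstant)) := by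
    have h1 := (((Real.GammaSeq_tendsto_Gamma y).abs.log (abs_ne_zero.2 hG)).add_const
      (Real.log y)).add (Real.tendsto_harmonic_sub_log.const_mul y)
    refine h1.congr' ?_
    filter_upwards [eventually_ne_atTop 0] with n hn using (sum_range_logGammaTerm hy hn).symm
  have hs := (summable_logGammaTerm y).hasSum
  rw [tendsto_nhds_unique hs.tendsto_sum_nat hlim] at hs
  have h0 := (hasSum_nat_add_iff (f := fun n => logGammaTerm n y) 1).1 hs
  rw [Finset.sum_range_one, logGammaTerm] at h0
  rwa [hval, show Real.log |Real.Gamma y| + Real.log y = Real.log |Real.Gamma y| + Real.log y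
    + y * Real.eulerMascheroniConstant + -Real.eulerMascheroniConstant * y by ring]

lemma measurable_logGammaTerm (n : ℕ) : Measurable (logGammaTerm n) := by
  cases n with
  | zero => unfold logGammaTerm; fun_prop
  | succ k => unfold logGammaTerm; fun_prop

/-- Uniform bounds that allow to integrate the Weierstrass product term by term. -/
lemma exists_integral_norm_logGammaTerm_mul_le {w : ℂ} (hw : w.im ≠ 0) {μ p : ℝ} (hp : 1 < p)
    (hp2 : p < 2) (hpμ : p ≤ μ) : ∃ B : ℝ, ∀ k : ℕ,
      Integrable (fun y : ℝ => (logGammaTerm (k + 1) y : ℂ) * ((y : ℂ) - w) ^ ((-(μ + 1) : ℝ) : ℂ)) ∧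
      ∫ y : ℝ, ‖(logGammaTerm (k + 1) y : ℂ) * ((y : ℂ) - w) ^ ((-(μ + 1) : ℝ) : ℂ)‖ ≤
        B * (1 / ((k : ℝ) + 1) ^ p) := by
  set g : ℝ → ℝ := fun u => |u - Real.log (1 + u)| * |u| ^ (-(p + 1)) with hg
  have hgi : Integrable g := integrable_abs_sub_log_one_add_mul_rpow hp hp2
  set B : ℝ := (1 + (1 + ‖w‖) / |w.im|) ^ (μ + 1) with hB
  have hB0 : 0 ≤ B := by positivity
  refine ⟨B * ∫ u, g u, fun k => ?_⟩
  have hk : (0 : ℝ) < (k : ℝ) + 1 := by positivity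
  have hbound : ∀ y : ℝ, ‖(logGammaTerm (k + 1) y : ℂ) * ((y : ℂ) - w) ^ ((-(μ + 1) : ℝ) : ℂ)‖ ≤
      B * ((k : ℝ) + 1) ^ (-(p + 1)) * g (y / ((k : ℝ) + 1)) := by
    intro y
    rcases eq_or_ne y 0 with rfl | hy
    · simp only [logGammaTerm, hg]
      simp
    have hy0 : 0 < |y| := abs_pos.2 hy
    have h1 := norm_ofReal_sub_cpow_le hw (q := μ + 1) (by linarith) y
    -- Lowering the exponent to `p + 1` with `p < 2` keeps the homogeneous weight integrable against
    -- the term near 0. Rescaling by `k + 1` then yields the factor `(k + 1)^{-p}`.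
    have h2 : (1 + |y|) ^ (-(μ + 1)) ≤ |y| ^ (-(p + 1)) :=
      (Real.rpow_le_rpow_of_exponent_le (by linarith) (by linarith)).trans
        (Real.rpow_le_rpow_of_nonpos hy0 (by linarith) (by linarith))
    have h3 : |y| ^ (-(p + 1)) = ((k : ℝ) + 1) ^ (-(p + 1)) * |y / ((k : ℝ) + 1)| ^ (-(p + 1)) := by
      rw [← Real.mul_rpow hk.le (abs_nonneg _), abs_div, abs_of_pos hk, mul_div_cancel₀ _ hk.ne']
    rw [norm_mul, Complex.norm_real, Real.norm_eq_abs]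
    simp only [hg, logGammaTerm]
    calc _ ≤ |y / ((k : ℝ) + 1) - Real.log (1 + y / ((k : ℝ) + 1))| * (B * |y| ^ (-(p + 1))) := by
          gcongr
          exact h1.trans (by gcongr)
      _ = _ := by rw [h3]; ring
  have hbi : Integrable fun y => B * ((k : ℝ) + 1) ^ (-(p + 1)) * g (y / ((k : ℝ) + 1)) :=
    (hgi.comp_div hk.ne').const_mul _
  have hint : Integrable
      (fun y : ℝ => (logGammaTerm (k + 1) y : ℂ) * ((y : ℂ) - w) ^ ((-(μ + 1) : ℝ) : ℂ)) := by
    refine hbi.mono' ?_ (ae_of_all _ hbound)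
    exact ((Complex.measurable_ofReal.comp (measurable_logGammaTerm (k + 1))).mul
      (continuous_ofReal_sub_cpow hw _).measurable).aestronglyMeasurable
  refine ⟨hint, (integral_mono hint.norm hbi hbound).trans_eq ?_⟩
  rw [integral_const_mul, Measure.integral_comp_div, abs_of_pos hk, smul_eq_mul,
    Real.rpow_neg hk.le, Real.rpow_add_one hk.ne']
  field_simp

lemma integrable_logGammaTerm_mul {w : ℂ} (hw : w.im ≠ 0) {μ : ℝ} (hμ : 1 < μ) (n : ℕ) :
    Integrable fun y : ℝ => (logGammaTerm n y : ℂ) * ((y : ℂ) - w) ^ ((-(μ + 1) : ℝ) : ℂ) := by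
  cases n with
  | zero =>
    have h := (integrable_ofReal_mul_ofReal_sub_cpow hw (q := μ + 1) (by linarith)).const_mul
      (-Real.eulerMascheroniConstant : ℂ)
    refine h.congr (ae_of_all _ fun y => ?_)
    simp only [logGammaTerm]
    push_cast
    ring
  | succ k =>
    obtain ⟨B, hB⟩ := exists_integral_norm_logGammaTerm_mul_le hw (μ := μ) (p := min μ (3 / 2))
      (lt_min hμ (by norm_num)) ((min_le_right _ _).trans_lt (by norm_num)) (min_le_left _ _)
    exact (hB k).1

lemma integral_logGammaTerm_zero_mul {w : ℂ} (hw : w.im ≠ 0) {μ : ℝ} (hμ : 1 < μ) :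
    ∫ y : ℝ, (logGammaTerm 0 y : ℂ) * ((y : ℂ) - w) ^ ((-(μ + 1) : ℝ) : ℂ) = 0 := by
  have h : ∀ y : ℝ, (logGammaTerm 0 y : ℂ) * ((y : ℂ) - w) ^ ((-(μ + 1) : ℝ) : ℂ) =
      (-Real.eulerMascheroniConstant : ℂ) * ((y : ℂ) * ((y : ℂ) - w) ^ ((-(μ + 1) : ℝ) : ℂ)) := by
    intro y
    simp only [logGammaTerm]
    push_cast
    ring
  simp only [h]
  rw [integral_const_mul, integral_ofReal_mul_ofReal_sub_cpow hw (by linarith), mul_zero]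

/-- Only `-log |y + κ|` contributes, since the constant and linear parts integrate to zero. The
translation `v = y + κ` moves the pole to `w + κ`. -/
lemma integral_logGammaTerm_succ_mul {w : ℂ} (hw : 0 < w.im) {μ : ℝ} (hμ : 1 < μ) (k : ℕ) :
    ∫ y : ℝ, (logGammaTerm (k + 1) y : ℂ) * ((y : ℂ) - w) ^ ((-(μ + 1) : ℝ) : ℂ) =
      Real.pi * Complex.I / μ * (-(w + (k + 1))) ^ ((-μ : ℝ) : ℂ) := by
  have hw' : w.im ≠ 0 := hw.ne'
  set κ : ℝ := (k : ℝ) + 1 with hκ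
  have hκ0 : κ ≠ 0 := by positivity
  set F : ℝ → ℂ := fun y => ((y : ℂ) - w) ^ ((-(μ + 1) : ℝ) : ℂ) with hF
  have hFi : Integrable F := integrable_ofReal_sub_cpow hw' (by linarith)
  have hyF : Integrable fun y : ℝ => (y : ℂ) * F y :=
    integrable_ofReal_mul_ofReal_sub_cpow hw' (by linarith)
  have htF : Integrable fun y : ℝ => (logGammaTerm (k + 1) y : ℂ) * F y :=
    integrable_logGammaTerm_mul hw' hμ (k + 1)
  have hae : (fun y : ℝ => (Real.log (y + κ) : ℂ) * F y) =ᵐ[volume]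
      fun y : ℝ => ((1 / κ : ℝ) : ℂ) * ((y : ℂ) * F y) + (Real.log κ : ℂ) * F y
        - (logGammaTerm (k + 1) y : ℂ) * F y := by
    have hne : ∀ᵐ y : ℝ, y ≠ -κ := by simp [ae_iff]
    filter_upwards [hne] with y hy
    have h1 : y + κ ≠ 0 := fun h => hy (by linarith)
    have h2 : Real.log (1 + y / κ) = Real.log (y + κ) - Real.log κ := by
      rw [← Real.log_div h1 hκ0]
      congr 1
      field_simp
      ring
    simp only [logGammaTerm, ← hκ, h2]
    push_cast
    ring
  have hi1 : Integrable fun y : ℝ => ((1 / κ : ℝ) : ℂ) * ((y : ℂ) * F y) := hyF.const_mul _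
  have hi2 : Integrable fun y : ℝ => (Real.log κ : ℂ) * F y := hFi.const_mul _
  have hi12 : Integrable fun y : ℝ =>
      ((1 / κ : ℝ) : ℂ) * ((y : ℂ) * F y) + (Real.log κ : ℂ) * F y := hi1.add hi2
  have hlog : Integrable fun y : ℝ => (Real.log (y + κ) : ℂ) * F y :=
    (hi12.sub htF).congr hae.symm
  have hval : ∫ y : ℝ, (Real.log (y + κ) : ℂ) * F y =
      -∫ y : ℝ, (logGammaTerm (k + 1) y : ℂ) * F y := by
    rw [integral_congr_ae hae, integral_sub hi12 htF, integral_add hi1 hi2,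
      integral_const_mul, integral_const_mul, integral_ofReal_sub_cpow hw' (by linarith),
      integral_ofReal_mul_ofReal_sub_cpow hw' (by linarith)]
    ring
  have hshift : ∀ y : ℝ, F y = (((y + κ : ℝ) : ℂ) - (w + κ)) ^ ((-(μ + 1) : ℝ) : ℂ) := by
    intro y
    simp only [hF]
    congr 1
    push_cast
    ring
  have hlog' : Integrable fun v : ℝ =>
      (Real.log v : ℂ) * ((v : ℂ) - (w + κ)) ^ ((-(μ + 1) : ℝ) : ℂ) := by
    have := hlog.comp_sub_right κ
    simpa only [hshift, sub_add_cancel] using this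
  have h3 := integral_log_mul_ofReal_sub_cpow (w := w + κ) (by simpa using hw) hμ hlog'
  rw [← integral_add_right_eq_self _ κ] at h3
  simp only [← hshift] at h3
  rw [hval, neg_eq_iff_eq_neg] at h3
  rw [h3, hκ]
  push_cast
  ring

lemma ofReal_sub_conj_cpow {w : ℂ} (hw : w.im ≠ 0) (q v : ℝ) :
    ((v : ℂ) - (starRingEnd ℂ) w) ^ (q : ℂ) = (starRingEnd ℂ) (((v : ℂ) - w) ^ (q : ℂ)) := by
  have h := Complex.cpow_conj ((v : ℂ) - (starRingEnd ℂ) w) (q : ℂ)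
    (Complex.mem_slitPlane_iff_arg.1 (ofReal_sub_mem_slitPlane (by simpa using hw) v)).1
  simpa using h

/-- The pairing of `log |Γ(y + 1)|` with a combination of conjugate power kernels. -/
lemma hasSum_integral_log_norm_Gamma_mul {w : ℂ} (hw : 0 < w.im) {μ : ℝ} (hμ : 1 < μ) (α β : ℂ) :
    HasSum (fun k : ℕ => Real.pi * Complex.I / μ * (α * (-(w + (k + 1))) ^ ((-μ : ℝ) : ℂ)
        - β * (starRingEnd ℂ) ((-(w + (k + 1))) ^ ((-μ : ℝ) : ℂ))))
      (∫ y : ℝ, (Real.log ‖Complex.Gamma ((y : ℂ) + 1)‖ : ℂ) *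
        (α * ((y : ℂ) - w) ^ ((-(μ + 1) : ℝ) : ℂ)
          + β * ((y : ℂ) - (starRingEnd ℂ) w) ^ ((-(μ + 1) : ℝ) : ℂ))) := by
  have hw' : w.im ≠ 0 := hw.ne'
  have hwc : ((starRingEnd ℂ) w).im ≠ 0 := by simpa using hw'
  set F : ℕ → ℝ → ℂ := fun n y =>
    (logGammaTerm n y : ℂ) * ((y : ℂ) - w) ^ ((-(μ + 1) : ℝ) : ℂ) with hF
  set F' : ℕ → ℝ → ℂ := fun n y =>
    (logGammaTerm n y : ℂ) * ((y : ℂ) - (starRingEnd ℂ) w) ^ ((-(μ + 1) : ℝ) : ℂ) with hF'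
  have hFi : ∀ n, Integrable (F n) := integrable_logGammaTerm_mul hw' hμ
  have hFi' : ∀ n, Integrable (F' n) := integrable_logGammaTerm_mul hwc hμ
  have hconj : ∀ n y, F' n y = (starRingEnd ℂ) (F n y) := by
    intro n y
    simp only [hF, hF', map_mul, Complex.conj_ofReal, ofReal_sub_conj_cpow hw']
  have hIconj : ∀ n, ∫ y, F' n y = (starRingEnd ℂ) (∫ y, F n y) := by
    intro n
    simp only [hconj]
    exact integral_conj
  have hI0 : ∫ y, F 0 y = 0 := integral_logGammaTerm_zero_mul hw' hμ
  have hI : ∀ k : ℕ, ∫ y, F (k + 1) y =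
      Real.pi * Complex.I / μ * (-(w + (k + 1))) ^ ((-μ : ℝ) : ℂ) :=
    integral_logGammaTerm_succ_mul hw hμ
  have hp1 : 1 < min μ (3 / 2) := lt_min hμ (by norm_num)
  have hp2 : min μ (3 / 2) < 2 := (min_le_right _ _).trans_lt (by norm_num)
  obtain ⟨B, hB⟩ := exists_integral_norm_logGammaTerm_mul_le hw' hp1 hp2 (min_le_left μ (3 / 2))
  have hsumF : Summable fun n => ∫ y, ‖F n y‖ := by
    rw [← summable_nat_add_iff 1]
    have hs : Summable fun k : ℕ => B * (1 / ((k : ℝ) + 1) ^ (min μ (3 / 2))) := by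
      have := (summable_nat_add_iff 1).2 (Real.summable_one_div_nat_rpow.2 hp1)
      simpa using this.mul_left B
    exact Summable.of_nonneg_of_le (fun k => integral_nonneg fun y => norm_nonneg _)
      (fun k => (hB k).2) hs
  have hint : ∀ n, Integrable fun y => α * F n y + β * F' n y := fun n =>
    ((hFi n).const_mul α).add ((hFi' n).const_mul β)
  have hsum : Summable fun n => ∫ y, ‖α * F n y + β * F' n y‖ := by
    refine Summable.of_nonneg_of_le (fun k => integral_nonneg fun y => norm_nonneg _) (fun n => ?_)
      (hsumF.mul_left (‖α‖ + ‖β‖))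
    rw [← integral_const_mul]
    refine integral_mono (hint n).norm ((hFi n).norm.const_mul _) fun y => ?_
    refine (norm_add_le _ _).trans_eq ?_
    rw [norm_mul α, norm_mul β, hconj, RCLike.norm_conj]
    ring
  have hmain := hasSum_integral_of_summable_integral_norm hint hsum
  have hval : ∀ n, ∫ y, (α * F n y + β * F' n y) = α * (∫ y, F n y) + β * ∫ y, F' n y := by
    intro n
    rw [integral_add ((hFi n).const_mul α) ((hFi' n).const_mul β), integral_const_mul,
      integral_const_mul]
  have hae : (fun y => ∑' n, (α * F n y + β * F' n y)) =ᵐ[volume] fun y : ℝ =>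
      (Real.log ‖Complex.Gamma ((y : ℂ) + 1)‖ : ℂ) *
        (α * ((y : ℂ) - w) ^ ((-(μ + 1) : ℝ) : ℂ)
          + β * ((y : ℂ) - (starRingEnd ℂ) w) ^ ((-(μ + 1) : ℝ) : ℂ)) := by
    have hne : ∀ᵐ y : ℝ, ∀ k : ℕ, y + k ≠ 0 := by
      rw [ae_all_iff]
      intro k
      have : ∀ᵐ y : ℝ, y ≠ -(k : ℝ) := by simp [ae_iff]
      filter_upwards [this] with y hy h
      exact hy (by linarith)
    filter_upwards [hne] with y hy
    have h := (Complex.hasSum_ofReal.2 (hasSum_logGammaTerm hy)).mul_right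
      (α * ((y : ℂ) - w) ^ ((-(μ + 1) : ℝ) : ℂ)
          + β * ((y : ℂ) - (starRingEnd ℂ) w) ^ ((-(μ + 1) : ℝ) : ℂ))
    rw [← h.tsum_eq]
    refine tsum_congr fun n => ?_
    simp only [hF, hF']
    ring
  -- The linear term of index 0 has zero integral, so the sum may start at index 1.
  rw [integral_congr_ae hae, ← hasSum_nat_add_iff' 1] at hmain
  simp only [hval, hIconj, Finset.sum_range_one, hI0, map_zero, mul_zero, add_zero, sub_zero, hI]
    at hmain
  have hfun : ∀ k : ℕ, α * (Real.pi * Complex.I / μ * (-(w + (k + 1))) ^ ((-μ : ℝ) : ℂ)) +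
      β * (starRingEnd ℂ) (Real.pi * Complex.I / μ * (-(w + (k + 1))) ^ ((-μ : ℝ) : ℂ)) =
      Real.pi * Complex.I / μ * (α * (-(w + (k + 1))) ^ ((-μ : ℝ) : ℂ)
        - β * (starRingEnd ℂ) ((-(w + (k + 1))) ^ ((-μ : ℝ) : ℂ))) := by
    intro k
    simp only [map_mul, map_div₀, Complex.conj_ofReal, Complex.conj_I]
    ring
  simpa only [hfun] using hmain

/-! ### The Fourier transform of the symbol -/

/-- The identity theorem for two functions that agree on a real half line. -/
lemma eqOn_of_eq_ofReal {f g : ℂ → ℂ} {U : Set ℂ} (hU : IsOpen U) (hUc : IsPreconnected U)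
    (hf : DifferentiableOn ℂ f U) (hg : DifferentiableOn ℂ g U) {b x₀ : ℝ} (hb : b < x₀)
    (hx₀ : (x₀ : ℂ) ∈ U) (h : ∀ x : ℝ, b < x → f x = g x) : Set.EqOn f g U := by
  refine (hf.analyticOnNhd hU).eqOn_of_preconnected_of_frequently_eq (hg.analyticOnNhd hU) hUc hx₀ ?_
  have ht : Tendsto (fun x : ℝ => (x : ℂ)) (𝓝[≠] x₀) (𝓝[≠] (x₀ : ℂ)) := by
    refine tendsto_nhdsWithin_iff.2
      ⟨(Complex.continuous_ofReal.tendsto x₀).mono_left nhdsWithin_le_nhds, ?_⟩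
    filter_upwards [self_mem_nhdsWithin] with x hx
    simpa using hx
  refine ht.frequently (Eventually.frequently ?_)
  filter_upwards [mem_nhdsWithin_of_mem_nhds (Ioi_mem_nhds hb)] with x hx using h x hx

lemma norm_ofReal_cpow_mul_cexp {t : ℝ} (ht : 0 < t) (μ : ℝ) (r : ℂ) :
    ‖(t : ℂ) ^ (μ : ℂ) * Complex.exp (-(r * t))‖ = t ^ μ * Real.exp (-r.re * t) := by
  rw [norm_mul, Complex.norm_cpow_eq_rpow_re_of_pos ht, Complex.norm_exp]
  simp

lemma continuousOn_ofReal_cpow_mul_cexp (μ r : ℂ) :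
    ContinuousOn (fun t : ℝ => (t : ℂ) ^ μ * Complex.exp (-(r * t))) (Set.Ioi 0) := by
  intro t ht
  refine ContinuousAt.continuousWithinAt (ContinuousAt.mul ?_ (by fun_prop))
  exact ContinuousAt.cpow (by fun_prop) continuousAt_const (Complex.ofReal_mem_slitPlane.2 ht)

lemma integrableOn_rpow_mul_exp_neg {μ b : ℝ} (hμ : -1 < μ) (hb : 0 < b) :
    IntegrableOn (fun t : ℝ => t ^ μ * Real.exp (-b * t)) (Set.Ioi 0) := by
  simpa using integrableOn_rpow_mul_exp_neg_mul_rpow (p := 1) hμ one_pos hb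

lemma integrableOn_ofReal_cpow_mul_cexp {μ : ℝ} (hμ : -1 < μ) {r : ℂ} (hr : 0 < r.re) :
    IntegrableOn (fun t : ℝ => (t : ℂ) ^ (μ : ℂ) * Complex.exp (-(r * t))) (Set.Ioi 0) := by
  refine (integrableOn_rpow_mul_exp_neg hμ hr).mono'
    ((continuousOn_ofReal_cpow_mul_cexp _ _).aestronglyMeasurable measurableSet_Ioi) ?_
  refine (ae_restrict_iff' measurableSet_Ioi).2 (ae_of_all _ fun t ht => ?_)
  exact (norm_ofReal_cpow_mul_cexp ht μ r).le

lemma differentiableOn_integral_ofReal_cpow_mul_cexp {μ : ℝ} (hμ : -1 < μ) :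
    DifferentiableOn ℂ (fun r : ℂ => ∫ t : ℝ in Set.Ioi 0, (t : ℂ) ^ (μ : ℂ) * Complex.exp (-(r * t)))
      {r | 0 < r.re} := by
  intro r₀ hr₀
  have hr₀ : 0 < r₀.re := hr₀
  have hs : {r : ℂ | r₀.re / 2 < r.re} ∈ 𝓝 r₀ :=
    (isOpen_lt continuous_const Complex.continuous_re).mem_nhds (half_lt_self hr₀)
  have h := hasDerivAt_integral_of_dominated_loc_of_deriv_le (𝕜 := ℂ)
    (μ := volume.restrict (Set.Ioi (0 : ℝ)))
    (F := fun (r : ℂ) (t : ℝ) => (t : ℂ) ^ (μ : ℂ) * Complex.exp (-(r * t)))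
    (F' := fun (r : ℂ) (t : ℝ) => (-t : ℂ) * ((t : ℂ) ^ (μ : ℂ) * Complex.exp (-(r * t))))
    (x₀ := r₀) (bound := fun t : ℝ => t ^ (μ + 1) * Real.exp (-(r₀.re / 2) * t)) hs
    (Eventually.of_forall fun r =>
      (continuousOn_ofReal_cpow_mul_cexp _ r).aestronglyMeasurable measurableSet_Ioi)
    (integrableOn_ofReal_cpow_mul_cexp hμ hr₀) ?_ ?_
    (integrableOn_rpow_mul_exp_neg (by linarith) (half_pos hr₀)) ?_
  · exact h.2.differentiableAt.differentiableWithinAt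
  · exact (ContinuousOn.mul (by fun_prop)
      (continuousOn_ofReal_cpow_mul_cexp _ r₀)).aestronglyMeasurable measurableSet_Ioi
  · refine (ae_restrict_iff' measurableSet_Ioi).2 (ae_of_all _ fun t ht r hr => ?_)
    have ht : 0 < t := ht
    have hr : r₀.re / 2 < r.re := hr
    rw [norm_mul, norm_ofReal_cpow_mul_cexp ht, norm_neg, Complex.norm_real,
      Real.norm_of_nonneg ht.le, Real.rpow_add_one ht.ne', mul_comm (t ^ μ) t, mul_assoc]
    gcongr
  · refine ae_of_all _ fun t r _ => ?_
    have h1 : HasDerivAt (fun r : ℂ => -(r * t)) (-(1 * (t : ℂ))) r :=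
      ((hasDerivAt_id r).mul_const (t : ℂ)).neg
    refine (h1.cexp.const_mul ((t : ℂ) ^ (μ : ℂ))).congr_deriv ?_
    ring

/-- The Euler integral for `Γ` with a complex scale. -/
lemma integral_ofReal_cpow_mul_cexp {μ : ℝ} (hμ : -1 < μ) {r : ℂ} (hr : 0 < r.re) :
    ∫ t : ℝ in Set.Ioi 0, (t : ℂ) ^ (μ : ℂ) * Complex.exp (-(r * t)) =
      Complex.Gamma ((μ : ℂ) + 1) * r ^ ((-(μ + 1) : ℝ) : ℂ) := by
  -- Both sides are holomorphic in the right half plane and agree for positive real `r`.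
  refine eqOn_of_eq_ofReal (f := fun r : ℂ => ∫ t : ℝ in Set.Ioi 0,
      (t : ℂ) ^ (μ : ℂ) * Complex.exp (-(r * t)))
    (g := fun r : ℂ => Complex.Gamma ((μ : ℂ) + 1) * r ^ ((-(μ + 1) : ℝ) : ℂ))
    (U := {r : ℂ | 0 < r.re}) (isOpen_lt continuous_const Complex.continuous_re)
    (convex_halfSpace_re_gt 0).isPreconnected
    (differentiableOn_integral_ofReal_cpow_mul_cexp hμ) ?_ (zero_lt_one (α := ℝ)) (by simp) ?_ hr
  · intro r hr
    refine DifferentiableAt.differentiableWithinAt (DifferentiableAt.const_mul ?_ _)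
    exact DifferentiableAt.cpow_const (by fun_prop) (Complex.mem_slitPlane_iff.2 (Or.inl hr))
  · intro x hx
    have h := Complex.integral_cpow_mul_exp_neg_mul_Ioi (a := (μ : ℂ) + 1) (r := x)
      (by simp; linarith) hx
    simp only [add_sub_cancel_right] at h
    rw [h, one_div, Complex.inv_cpow _ _ (by
      rw [Complex.arg_ofReal_of_nonneg hx.le]; exact Real.pi_pos.ne), ← Complex.cpow_neg, mul_comm]
    push_cast
    rfl

/-- The argument of `z` lies in `(-π, 0)`, so a quarter turn forward does not cross the cut. -/
lemma I_mul_cpow {z : ℂ} (hz : z.im < 0) (c : ℂ) :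
    (Complex.I * z) ^ c = z ^ c * Complex.exp (Real.pi / 2 * Complex.I * c) := by
  have hz0 : z ≠ 0 := by rintro rfl; simp at hz
  have h1 := Complex.arg_neg_iff.2 hz
  have h2 := Complex.neg_pi_lt_arg z
  have hpi := Real.pi_pos
  rw [Complex.cpow_def_of_ne_zero (mul_ne_zero Complex.I_ne_zero hz0),
    Complex.cpow_def_of_ne_zero hz0, Complex.log_mul Complex.I_ne_zero hz0, Complex.log_I,
    ← Complex.exp_add]
  · congr 1; ring
  · rw [Complex.arg_I]; constructor <;> linarith

lemma neg_I_mul_cpow {z : ℂ} (hz : 0 < z.im) (c : ℂ) :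
    (-Complex.I * z) ^ c = z ^ c * Complex.exp (-(Real.pi / 2 * Complex.I * c)) := by
  have hz0 : z ≠ 0 := by rintro rfl; simp at hz
  have h1 : 0 ≤ z.arg := Complex.arg_nonneg_iff.2 hz.le
  have h2 := Complex.arg_le_pi z
  have hpi := Real.pi_pos
  have hI : -Complex.I ≠ 0 := neg_ne_zero.2 Complex.I_ne_zero
  rw [Complex.cpow_def_of_ne_zero (mul_ne_zero hI hz0),
    Complex.cpow_def_of_ne_zero hz0, Complex.log_mul hI hz0, Complex.log_neg_I,
    ← Complex.exp_add]
  · congr 1; ring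
  · rw [Complex.arg_neg_I]; constructor <;> linarith

/-- Each half line of `ξ` gives an Euler integral, with scales `ε ± i(y - x)`. Pulling out `±i`
contributes `e^{∓iπ(μ+1)/2}`, and the chosen branch contributes `e^{iπμ}` for `ξ < 0`; with
`e^{iπμ/2}` the phases become `-i` and `i e^{2πiμ}`. -/
lemma fourierT_fracDerivSymbol {ε : ℝ} (hε : 0 < ε) (x : ℝ) {μ : ℝ} (hμ : 0 < μ) (y : ℝ) :
    fourierT (fracDerivSymbol ε x μ) y =
      -Complex.I * Complex.Gamma ((μ : ℂ) + 1) *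
          ((y : ℂ) - (x + ε * Complex.I)) ^ ((-(μ + 1) : ℝ) : ℂ)
        + Complex.I * Complex.exp (2 * Real.pi * Complex.I * μ) * Complex.Gamma ((μ : ℂ) + 1) *
          ((y : ℂ) - (starRingEnd ℂ) (x + ε * Complex.I)) ^ ((-(μ + 1) : ℝ) : ℂ) := by
  set A : ℂ := Complex.exp (Complex.I * Real.pi / 2 * μ) with hA
  set r₁ : ℂ := Complex.I * ((y : ℂ) - (x + ε * Complex.I)) with hr₁
  set r₂ : ℂ := -Complex.I * ((y : ℂ) - (starRingEnd ℂ) (x + ε * Complex.I)) with hr₂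
  have hr₁re : r₁.re = ε := by simp [hr₁]
  have hr₂re : r₂.re = ε := by simp [hr₂]
  have hr₁' : r₁ = ε + Complex.I * (y - x) := by
    rw [hr₁]; linear_combination (-ε : ℂ) * Complex.I_mul_I
  have hr₂' : r₂ = ε - Complex.I * (y - x) := by
    rw [hr₂]
    simp only [map_add, map_mul, Complex.conj_ofReal, Complex.conj_I]
    linear_combination (-ε : ℂ) * Complex.I_mul_I
  set φ : ℝ → ℂ := fun ξ => fracDerivSymbol ε x μ ξ * Complex.exp (-(Complex.I * y * ξ)) with hφ
  have hpos : ∀ ξ ∈ Set.Ioi (0 : ℝ),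
      φ ξ = A * ((ξ : ℂ) ^ (μ : ℂ) * Complex.exp (-(r₁ * ξ))) := by
    intro ξ hξ
    have hξ : 0 < ξ := hξ
    simp only [hφ, fracDerivSymbol, iMulPow, abs_of_pos hξ]
    rw [mul_assoc, mul_assoc, ← Complex.exp_add, ← Complex.exp_add, mul_assoc, hr₁']
    congr 3
    push_cast
    ring
  have hneg : ∀ ξ ∈ Set.Ioi (0 : ℝ), φ (-ξ) =
      A * Complex.exp (Real.pi * Complex.I * μ) *
        ((ξ : ℂ) ^ (μ : ℂ) * Complex.exp (-(r₂ * ξ))) := by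
    intro ξ hξ
    have hξ : 0 < ξ := hξ
    simp only [hφ, fracDerivSymbol, iMulPow, abs_neg, abs_of_pos hξ]
    rw [Complex.ofReal_cpow_of_nonpos (x := -ξ) (by linarith), mul_assoc (A * _), mul_assoc (A * _),
      ← Complex.exp_add, ← Complex.exp_add, hr₂', Complex.ofReal_neg, neg_neg]
    rw [show Complex.I * (x : ℂ) * -(ξ : ℂ) + -((ε * ξ : ℝ) : ℂ) +
      -(Complex.I * y * -(ξ : ℂ)) =
      -((ε - Complex.I * (y - x)) * ξ) by push_cast; ring]
    ring
  have hi1 : IntegrableOn φ (Set.Ioi 0) :=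
    IntegrableOn.congr_fun
      ((integrableOn_ofReal_cpow_mul_cexp (by linarith) (hr₁re ▸ hε)).const_mul A)
      (fun ξ hξ => (hpos ξ hξ).symm) measurableSet_Ioi
  have hi2 : IntegrableOn (fun ξ => φ (-ξ)) (Set.Ioi 0) :=
    IntegrableOn.congr_fun
      ((integrableOn_ofReal_cpow_mul_cexp (by linarith) (hr₂re ▸ hε)).const_mul
        (A * Complex.exp (Real.pi * Complex.I * μ)))
      (fun ξ hξ => (hneg ξ hξ).symm) measurableSet_Ioi
  have hi3 : IntegrableOn φ (Set.Iic 0) := by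
    rw [integrableOn_Iic_iff_integrableOn_Iio]
    have := IntegrableOn.comp_neg_Iio (c := (0 : ℝ)) (f := fun ξ => φ (-ξ)) (by simpa using hi2)
    simpa using this
  have hsplit : fourierT (fracDerivSymbol ε x μ) y =
      (∫ ξ in Set.Ioi 0, φ (-ξ)) + ∫ ξ in Set.Ioi 0, φ ξ := by
    rw [integral_comp_neg_Ioi, neg_zero, ← setIntegral_union (Set.Iic_disjoint_Ioi le_rfl)
      measurableSet_Ioi hi3 hi1, Set.Iic_union_Ioi, setIntegral_univ]
    rfl
  rw [hsplit, setIntegral_congr_fun measurableSet_Ioi hneg,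
    setIntegral_congr_fun measurableSet_Ioi hpos, integral_const_mul, integral_const_mul,
    integral_ofReal_cpow_mul_cexp (by linarith) (hr₂re ▸ hε),
    integral_ofReal_cpow_mul_cexp (by linarith) (hr₁re ▸ hε), hr₁, hr₂,
    I_mul_cpow (by simpa using hε), neg_I_mul_cpow (by simpa using hε)]
  have e1 : A * Complex.exp (Real.pi / 2 * Complex.I * ((-(μ + 1) : ℝ) : ℂ)) = -Complex.I := by
    rw [hA, ← Complex.exp_add, ← Complex.exp_neg_pi_div_two_mul_I]
    congr 1
    push_cast
    ring
  have e2 : A * Complex.exp (Real.pi * Complex.I * μ) *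
      Complex.exp (-(Real.pi / 2 * Complex.I * ((-(μ + 1) : ℝ) : ℂ))) =
      Complex.I * Complex.exp (2 * Real.pi * Complex.I * μ) := by
    rw [show Complex.I * Complex.exp (2 * Real.pi * Complex.I * μ) =
        Complex.exp (Real.pi / 2 * Complex.I) * Complex.exp (2 * Real.pi * Complex.I * μ) by
        rw [Complex.exp_pi_div_two_mul_I], hA, ← Complex.exp_add, ← Complex.exp_add,
      ← Complex.exp_add]
    congr 1
    push_cast
    ring
  rw [← e1, ← e2]
  ring

/-! ### The derivative side and the Hurwitz zeta function -/

lemma hasSum_derivSideIntegral {ε : ℝ} (hε : 0 < ε) (x : ℝ) {μ : ℝ} (hμ : 1 < μ) :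
    HasSum (fun k : ℕ => -(1 / 2 : ℂ) *
      ((-(x + ε * Complex.I + (k + 1))) ^ ((-μ : ℝ) : ℂ)
        + Complex.exp (2 * Real.pi * Complex.I * μ) *
          (starRingEnd ℂ) ((-(x + ε * Complex.I + (k + 1))) ^ ((-μ : ℝ) : ℂ))))
      (derivSideIntegral (fun z => Complex.Gamma (z + 1)) ε x μ) := by
  have hμ0 : (μ : ℂ) ≠ 0 := by exact_mod_cast (by linarith : μ ≠ 0)
  have hG : Complex.Gamma μ ≠ 0 := Complex.Gamma_ne_zero_of_re_pos (by simp; linarith)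
  have hpi : (Real.pi : ℂ) ≠ 0 := by exact_mod_cast Real.pi_ne_zero
  have h := (hasSum_integral_log_norm_Gamma_mul (w := x + ε * Complex.I) (by simpa using hε) hμ
    (-Complex.I * Complex.Gamma ((μ : ℂ) + 1))
    (Complex.I * Complex.exp (2 * Real.pi * Complex.I * μ) * Complex.Gamma ((μ : ℂ) + 1))).mul_left
    (-(1 / Complex.Gamma μ) * (1 / (2 * Real.pi)))
  simp only [← fourierT_fracDerivSymbol hε x (by linarith : 0 < μ)] at h
  have hterm : ∀ P Q E : ℂ, -(1 / Complex.Gamma μ) * (1 / (2 * Real.pi)) *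
      (Real.pi * Complex.I / μ * (-Complex.I * Complex.Gamma ((μ : ℂ) + 1) * P -
        Complex.I * E * Complex.Gamma ((μ : ℂ) + 1) * Q)) = -(1 / 2 : ℂ) * (P + E * Q) := by
    intro P Q E
    rw [Complex.Gamma_add_one _ hμ0]
    field_simp
    linear_combination (P + E * Q) * Complex.I_sq
  simp only [hterm] at h
  exact h

/-- The base approaches `-a` from below, so its logarithm tends to `log a - πi`; the exponent `-μ`
turns this into the phase `e^{iπμ}`. -/
lemma tendsto_neg_ofReal_sub_mul_I_cpow {a : ℝ} (ha : 0 < a) (μ : ℝ) :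
    Tendsto (fun ε : ℝ => (((-a : ℝ) : ℂ) - ε * Complex.I) ^ ((-μ : ℝ) : ℂ)) (𝓝[>] 0)
      (𝓝 (Complex.exp (Complex.I * Real.pi * μ) * (a : ℂ) ^ (-(μ : ℂ)))) := by
  have h1 := tendsto_log_ofReal_sub_mul_I (v := -a) (by linarith)
  rw [if_pos (by linarith), Real.log_neg_eq_log, Complex.ofReal_log ha.le] at h1
  have h2 := ((h1.mul_const ((-μ : ℝ) : ℂ))).cexp
  have ha0 : (a : ℂ) ≠ 0 := by exact_mod_cast ha.ne'
  have h3 : Complex.exp ((Complex.log a - Real.pi * Complex.I) * ((-μ : ℝ) : ℂ)) =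
      Complex.exp (Complex.I * Real.pi * μ) * (a : ℂ) ^ (-(μ : ℂ)) := by
    rw [Complex.cpow_def_of_ne_zero ha0, ← Complex.exp_add]
    congr 1
    push_cast
    ring
  rw [h3] at h2
  refine h2.congr' ?_
  filter_upwards [self_mem_nhdsWithin] with ε hε
  have hε : 0 < ε := hε
  rw [Complex.cpow_def_of_ne_zero]
  exact Complex.slitPlane_ne_zero (mem_slitPlane_of_im_neg (by simpa using hε))

/-- The series is dominated by `∑ (x + 1 + k)^{-μ}` uniformly in `ε`, so the limit is taken
termwise. The two conjugate halves have the same limit because `e^{2πiμ} e^{-iπμ} = e^{iπμ}`, which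
cancels the factor `1/2`. -/
lemma tendsto_derivSideIntegral {x μ : ℝ} (hx : -1 < x) (hμ : 1 < μ) :
    Tendsto (fun ε : ℝ => derivSideIntegral (fun z => Complex.Gamma (z + 1)) ε x μ) (𝓝[>] 0)
      (𝓝 (-Complex.exp (Complex.I * Real.pi * μ) * hurwitz μ ((x : ℂ) + 1))) := by
  set E : ℂ := Complex.exp (2 * Real.pi * Complex.I * μ) with hE
  have hEn : ‖E‖ = 1 := by
    rw [hE, show 2 * (Real.pi : ℂ) * Complex.I * μ = ((2 * Real.pi * μ : ℝ) : ℂ) * Complex.I by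
      push_cast; ring, Complex.norm_exp_ofReal_mul_I]
  set a : ℕ → ℝ := fun k => x + 1 + k with ha
  have ha0 : ∀ k, 0 < a k := fun k => by
    have : (0 : ℝ) ≤ k := k.cast_nonneg
    simp only [ha]
    linarith
  set P : ℝ → ℕ → ℂ := fun ε k => (((-a k : ℝ) : ℂ) - ε * Complex.I) ^ ((-μ : ℝ) : ℂ) with hP
  have hPeq : ∀ (ε : ℝ) (k : ℕ), (-(x + ε * Complex.I + (k + 1))) ^ ((-μ : ℝ) : ℂ) = P ε k := by
    intro ε k
    simp only [hP, ha]
    congr 1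
    push_cast
    ring
  have hPn : ∀ ε k, ‖P ε k‖ ≤ a k ^ (-μ) := by
    intro ε k
    simp only [hP, Complex.norm_cpow_real]
    refine Real.rpow_le_rpow_of_nonpos (ha0 k) ?_ (by linarith)
    have := (neg_le_abs _).trans (Complex.abs_re_le_norm (((-a k : ℝ) : ℂ) - ε * Complex.I))
    simpa using this
  have hsum : Summable fun k => a k ^ (-μ) := by
    refine ((Real.summable_one_div_nat_add_rpow (x + 1) μ).2 hμ).congr fun k => ?_
    have h1 : (k : ℝ) + (x + 1) = a k := by simp only [ha]; ring
    rw [h1, abs_of_pos (ha0 k), Real.rpow_neg (ha0 k).le, one_div]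
  have hcpow : ∀ k, (a k : ℂ) ^ (-(μ : ℂ)) = ((a k ^ (-μ) : ℝ) : ℂ) := by
    intro k
    rw [Complex.ofReal_cpow (ha0 k).le, Complex.ofReal_neg]
  have hlim : ∀ k, Tendsto (fun ε => -(1 / 2 : ℂ) * (P ε k + E * (starRingEnd ℂ) (P ε k))) (𝓝[>] 0)
      (𝓝 (-Complex.exp (Complex.I * Real.pi * μ) * (a k : ℂ) ^ (-(μ : ℂ)))) := by
    intro k
    have h1 := tendsto_neg_ofReal_sub_mul_I_cpow (ha0 k) μ
    have h2 := (Complex.continuous_conj.tendsto _).comp h1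
    have h3 := (h1.add (h2.const_mul E)).const_mul (-(1 / 2 : ℂ))
    have h4 : -(1 / 2 : ℂ) * (Complex.exp (Complex.I * Real.pi * μ) * (a k : ℂ) ^ (-(μ : ℂ)) +
        E * (starRingEnd ℂ) (Complex.exp (Complex.I * Real.pi * μ) * (a k : ℂ) ^ (-(μ : ℂ)))) =
        -Complex.exp (Complex.I * Real.pi * μ) * (a k : ℂ) ^ (-(μ : ℂ)) := by
      rw [hcpow, map_mul, Complex.conj_ofReal, ← Complex.exp_conj]
      simp only [map_mul, Complex.conj_I, Complex.conj_ofReal]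
      have h5 : E * Complex.exp (-Complex.I * Real.pi * μ) =
          Complex.exp (Complex.I * Real.pi * μ) := by
        rw [hE, ← Complex.exp_add]
        congr 1
        ring
      rw [← mul_assoc E, h5]
      ring
    rw [h4] at h3
    exact h3
  have hmain := tendsto_tsum_of_dominated_convergence hsum hlim
    (Eventually.of_forall fun ε k => by
      rw [norm_mul]
      have h1 := norm_add_le (P ε k) (E * (starRingEnd ℂ) (P ε k))
      rw [norm_mul, hEn, one_mul, RCLike.norm_conj] at h1
      have h2 : ‖-(1 / 2 : ℂ)‖ = 1 / 2 := by simp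
      rw [h2]
      linarith [hPn ε k])
  have hval : ∑' k, -Complex.exp (Complex.I * Real.pi * μ) * (a k : ℂ) ^ (-(μ : ℂ)) =
      -Complex.exp (Complex.I * Real.pi * μ) * hurwitz μ ((x : ℂ) + 1) := by
    rw [tsum_mul_left]
    congr 1
    have hslit : (x : ℂ) + 1 ∈ Complex.slitPlane := by
      rw [Complex.mem_slitPlane_iff]
      left
      simp
      linarith
    have h1 := tendsto_sum_hurwitz (s := μ) (by simpa using hμ) hslit
    have h2 : Summable fun k => (a k : ℂ) ^ (-(μ : ℂ)) := by
      simp only [hcpow]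
      exact Complex.summable_ofReal.2 hsum
    refine tendsto_nhds_unique h2.hasSum.tendsto_sum_nat ?_
    refine h1.congr fun N => Finset.sum_congr rfl fun k _ => ?_
    simp only [ha]
    push_cast
    rfl
  rw [hval] at hmain
  refine hmain.congr' ?_
  filter_upwards [self_mem_nhdsWithin] with ε hε
  rw [← (hasSum_derivSideIntegral hε x hμ).tsum_eq]
  simp only [hPeq, hE]

lemma isGammaDerivSide_hurwitz :
    IsGammaDerivSide fun z s => -Complex.exp (Complex.I * Real.pi * s) * hurwitz s (z + 1) where
  integral _ _ hx hμ := tendsto_derivSideIntegral hx hμ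
  analytic_mu x hx s hs := by
    have hslit : (x : ℂ) + 1 ∈ Complex.slitPlane := by
      rw [Complex.mem_slitPlane_iff]
      left
      simp
      linarith
    exact (DifferentiableAt.mul (by fun_prop)
      (differentiableAt_hurwitz_left hs hslit)).differentiableWithinAt
  analytic_z s hs z hz := by
    refine (DifferentiableAt.const_mul ?_ _).differentiableWithinAt
    exact DifferentiableAt.comp z (g := fun a => hurwitz s a) (f := fun z => z + 1)
      (differentiableAt_hurwitz_right hs hz) (by fun_prop)

/-! ### Uniqueness of the continuation. -/

lemma isOpen_cutPlane : IsOpen cutPlane :=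
  Complex.isOpen_slitPlane.preimage (continuous_id.add continuous_const)

lemma isPreconnected_cutPlane : IsPreconnected cutPlane := by
  have h : cutPlane = (fun z : ℂ => z - 1) '' Complex.slitPlane := by
    ext z
    constructor
    · intro hz
      exact ⟨z + 1, hz, by ring⟩
    · rintro ⟨w, hw, rfl⟩
      change w - 1 + 1 ∈ Complex.slitPlane
      rwa [sub_add_cancel]
  rw [h]
  have h1 : IsPreconnected Complex.slitPlane :=
    (Complex.starConvex_one_slitPlane.isPathConnected
      Complex.one_mem_slitPlane).isConnected.isPreconnected
  exact h1.image _ (by fun_prop)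

/-- The identity theorem twice: in `μ` on the connected punctured plane, from the half line `μ > 1`
where both are the same limit, then in `z` on the cut plane, from `z > -1`. -/
lemma IsGammaDerivSide.eq {d d' : ℂ → ℂ → ℂ} (hd : IsGammaDerivSide d) (hd' : IsGammaDerivSide d')
    {z : ℂ} (hz : z ∈ cutPlane) {μ : ℂ} (hμ : μ ≠ 1) : d z μ = d' z μ := by
  have hreal : ∀ x : ℝ, -1 < x → d x μ = d' x μ := by
    intro x hx
    refine eqOn_of_eq_ofReal (U := {1}ᶜ) isOpen_compl_singleton
      (isConnected_compl_singleton_of_one_lt_rank (by simp) 1).isPreconnected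
      (hd.analytic_mu x hx) (hd'.analytic_mu x hx) (b := 1) (x₀ := 2) (by norm_num) (by simp) ?_ hμ
    intro ν hν
    exact tendsto_nhds_unique (hd.integral x ν hx hν) (hd'.integral x ν hx hν)
  refine eqOn_of_eq_ofReal isOpen_cutPlane isPreconnected_cutPlane (hd.analytic_z μ hμ)
    (hd'.analytic_z μ hμ) (b := -1) (x₀ := 0) (by norm_num) ?_ hreal hz
  simp [cutPlane]

lemma isGammaDerivSide_gammaDerivSide : IsGammaDerivSide gammaDerivSide := by
  have h : ∃ d, IsGammaDerivSide d := ⟨_, isGammaDerivSide_hurwitz⟩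
  rw [gammaDerivSide, dif_pos h]
  exact h.choose_spec

/-- The derivative side for `Γ(z + 1)` is `-e^{iπμ} ζ(μ, z + 1)`. -/
lemma gammaDerivSide_eq_hurwitz {z : ℂ} (hz : z ∈ cutPlane) {μ : ℂ} (hμ : μ ≠ 1) :
    gammaDerivSide z μ = -Complex.exp (Complex.I * Real.pi * μ) * hurwitz μ (z + 1) :=
  isGammaDerivSide_gammaDerivSide.eq isGammaDerivSide_hurwitz hz hμ

/-! ### The expansion in sectors. -/

lemma sector_subset_cutPlane {δ : ℝ} (hδ : 0 < δ) : sector δ ⊆ cutPlane := by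
  rintro z ⟨h0, harg⟩
  refine Complex.mem_slitPlane_iff_arg.2 ⟨fun h => ?_, h0⟩
  rw [h, abs_of_pos Real.pi_pos] at harg
  linarith

/-- In the sector `cos (arg (z + 1)) ≥ cos (π - δ) = -cos δ`, the cone condition with `κ = cos δ`.
The minimum with `π` keeps `κ < 1` for every `δ > 0`; it is harmless because a nonempty sector has
`δ ≤ π`. -/
lemma neg_cos_mul_norm_le_re_of_mem_sector {δ : ℝ} (hδ : 0 < δ) {z : ℂ} (hz : z ∈ sector δ) :
    -(Real.cos (min δ Real.pi) * ‖z + 1‖) ≤ (z + 1).re := by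
  have hδπ : δ ≤ Real.pi := by linarith [hz.2, abs_nonneg (z + 1).arg]
  rw [min_eq_left hδπ, ← Complex.norm_mul_cos_arg, ← Real.cos_abs (z + 1).arg]
  have h := Real.cos_le_cos_of_nonneg_of_le_pi (abs_nonneg (z + 1).arg) (by linarith) hz.2
  rw [Real.cos_pi_sub] at h
  nlinarith [norm_nonneg (z + 1)]

/-- The derivative side agrees with its Euler–Maclaurin expansion up to the order of the first
omitted term, uniformly in sectors. -/
lemma isBigO_gammaDerivSide_sub {μ : ℝ} (hμ : μ ≠ 1) (K : ℕ) {δ : ℝ} (hδ : 0 < δ) :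
    (fun z : ℂ => gammaDerivSide z μ -
        -Complex.exp (Complex.I * Real.pi * μ) * hurwitzApprox μ (2 * K + 1) (z + 1))
      =O[Bornology.cobounded ℂ ⊓ 𝓟 (sector δ)]
        (fun z : ℂ => ‖z + 1‖ ^ (-(μ + 2 * K + 1))) := by
  have hpi := Real.pi_pos
  have hκ : Real.cos (min δ Real.pi) < 1 := by
    rw [← Real.cos_zero]
    exact Real.cos_lt_cos_of_nonneg_of_le_pi le_rfl (min_le_right _ _) (lt_min hδ hpi)
  obtain ⟨C, hC⟩ := exists_norm_hurwitz_sub_hurwitzApprox_le hμ (Real.neg_one_le_cos _) hκ K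
  have hs : (μ : ℂ) ≠ 1 := by exact_mod_cast hμ
  refine IsBigO.of_bound (‖Complex.exp (Complex.I * Real.pi * μ)‖ * C) ?_
  rw [eventually_inf_principal]
  have hlarge : ∀ᶠ z : ℂ in Bornology.cobounded ℂ, 2 ≤ ‖z‖ :=
    tendsto_norm_cobounded_atTop.eventually_ge_atTop 2
  filter_upwards [hlarge] with z hz hzs
  have hcut := sector_subset_cutPlane hδ hzs
  have h1 : 1 ≤ ‖z + 1‖ := by
    have := norm_sub_le (z + 1) 1
    rw [add_sub_cancel_right, norm_one] at this
    linarith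
  rw [gammaDerivSide_eq_hurwitz hcut hs, ← mul_sub, norm_mul, norm_neg,
    Real.norm_of_nonneg (by positivity), mul_assoc ‖_‖]
  exact mul_le_mul_of_nonneg_left
    (hC (z + 1) hcut h1 (neg_cos_mul_norm_le_re_of_mem_sector hδ hzs)) (norm_nonneg _)

end GammaRoot

theorem mainTheorem3 :
    -- the derivative side is well defined: the continuation exists and is unique
    GammaRoot.IsGammaDerivSide GammaRoot.gammaDerivSide ∧
    (∀ d : ℂ → ℂ → ℂ, GammaRoot.IsGammaDerivSide d →
      ∀ z ∈ GammaRoot.cutPlane, ∀ μ : ℂ, μ ≠ 1 → d z μ = GammaRoot.gammaDerivSide z μ) ∧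
    -- the asymptotic expansion, in both forms, for every non-integer real `μ`
    (∀ μ : ℝ, (∀ n : ℤ, μ ≠ n) → ∀ K : ℕ,
      (∀ δ : ℝ, 0 < δ →
        (fun z : ℂ => GammaRoot.gammaDerivSide z μ - GammaRoot.expansionSum μ K z)
          =O[Bornology.cobounded ℂ ⊓ 𝓟 (GammaRoot.sector δ)]
            (fun z : ℂ => ‖z + 1‖ ^ (-(μ + 2 * K + 1)))) ∧
      (∀ δ : ℝ, 0 < δ →
        (fun z : ℂ => GammaRoot.gammaDerivSide z μ - GammaRoot.expansionFactored μ K z)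
          =O[Bornology.cobounded ℂ ⊓ 𝓟 (GammaRoot.sector δ)]
            (fun z : ℂ => ‖z + 1‖ ^ (-(μ + 2 * K + 1)))) ∧
      (∀ z ∈ GammaRoot.cutPlane,
        GammaRoot.expansionSum μ K z = GammaRoot.expansionFactored μ K z)) := by
  refine ⟨GammaRoot.isGammaDerivSide_gammaDerivSide, fun d hd z hz μ hμ =>
    hd.eq GammaRoot.isGammaDerivSide_gammaDerivSide hz hμ, fun μ hμ K => ?_⟩
  have hμ1 : μ ≠ 1 := by simpa using hμ 1
  refine ⟨fun δ hδ => ?_, fun δ hδ => ?_, fun z hz => ?_⟩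
  · simpa only [GammaRoot.expansionSum_eq_hurwitzApprox μ hμ1] using
      GammaRoot.isBigO_gammaDerivSide_sub hμ1 K hδ
  · refine (GammaRoot.isBigO_gammaDerivSide_sub hμ1 K hδ).congr' ?_ EventuallyEq.rfl
    filter_upwards [mem_inf_of_right (mem_principal_self _)] with z hz
    rw [GammaRoot.expansionFactored_eq_hurwitzApprox μ hμ1 K hz.1]
  · rw [GammaRoot.expansionSum_eq_hurwitzApprox μ hμ1,
      GammaRoot.expansionFactored_eq_hurwitzApprox μ hμ1 K (Complex.slitPlane_ne_zero hz)]
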